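/- Let $K$ be a field of characteristic zero or $K=\mathbb Z$, let $n,m\ge 0$, and let $\Sigma=(\mathbf x,\mathbf y,B)$ be a seed. That is, $\mathbf x=(x_1,\dots,x_n)$ and $\mathbf y=(x_{n+1},\dots,x_{n+m})$, where $x_1,\dots,x_{n+m}$ are algebraically independent over $K$, and $B=(b_{ij})$ is an $(n+m)\times n$ integer matrix whose first $n$ rows form a skew-symmetrizable matrix (there are positive integers $d_1,\dots,d_n$ with $d_ib_{ij}=-d_jb_{ji}$ for all $i,j\le n$). If $K$ is a field, assume moreover that the ice quiver of $B$ has no isolated exchangeable vertex, i.e. that no column of $B$ is zero. Let $\mathcal F$ be the field of fractions of $K[x_1,\dots,x_{n+m}]$. For $1\le i\le n$, the mutation $\mu_i(\Sigma)$ is obtained from $\Sigma$ by replacing $x_i$ with $$x_i'=\frac1{x_i}\Bigl(\prod_{b_{ki}>0}x_k^{b_{ki}}+\prod_{b_{ki}<0}x_k^{-b_{ki}}\Bigr)\in\mathcal F$$ and $B$ with the matrix $(b'_{jk})$, where $b'_{jk}=-b_{jk}$ if $j=i$ or $k=i$, and $b'_{jk}=b_{jk}+\tfrac12\bigl(|b_{ji}|b_{ik}+b_{ji}|b_{ik}|\bigr)$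 otherwise. A seed is mutation-equivalent to $\Sigma$ if it is obtained from $\Sigma$ by a finite sequence of mutations. The cluster variables are the first $n$ variables of all the seeds that are mutation-equivalent to $\Sigma$; let $\mathcal X$ be the set of all of them. Consider the $K$-subalgebras of $\mathcal F$ $$\mathcal A=K\bigl[x,\,y^{\pm1}\mid x\in\mathcal X,\ y\in\{x_{n+1},\dots,x_{n+m}\}\bigr],\qquad \mathcal U=\bigcap_{(\mathbf z,\mathbf y,C)}K\bigl[z_1^{\pm1},\dots,z_n^{\pm1},x_{n+1}^{\pm1},\dots,x_{n+m}^{\pm1}\bigr],$$ where the intersection is over all seeds $(\mathbf z,\mathbf y,C)$ that are mutation-equivalent to $\Sigma$ (the cluster algebra and the upper cluster algebra of $\Sigma$). Then every cluster variable belongs to both $\mathcal A$ and $\mathcal U$ and is a strong atom (absolutely irreducible) in each of these two rings. Here an element $u$ of a domain $H$ is a strong atom if $u$ is an atom (irreducible element) of $H$ and, for every integer $\ell>1$, the only factorization of $u^\ell$ into atoms of $H$, up to order and associates, is $u^\ell=u\cdots u$. -/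

import Mathlib

namespace ClusterAlg

/-- An element `u` of a commutative monoid is a *strong atom* (absolutely irreducible) if it is an
atom and, for every `n > 1`, the only factorization of `u ^ n` into atoms is `u ⋯ u` (`n` factors),
up to order and associates. -/
def IsStrongAtom {M : Type*} [CommMonoid M] (u : M) : Prop :=
  Irreducible u ∧
    ∀ n : ℕ, 1 < n → ∀ s : Multiset M, (∀ a ∈ s, Irreducible a) → s.prod = u ^ n →
      Multiset.Rel Associated s (Multiset.replicate n u)

section Matrices

variable {ι κ : Type*}

/-- Integer matrices with rows indexed by `ι ⊕ κ` (exchangeable and frozen indices) and columns by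
`ι` are *exchange matrices* if the principal part `P` (the rows in `ι`) is skew-symmetrizable:
`D * P` is skew-symmetric for some diagonal matrix `D` with positive integer entries. -/
def IsExchangeMatrix (B : Matrix (ι ⊕ κ) ι ℤ) : Prop :=
  ∃ d : ι → ℕ, (∀ i, 0 < d i) ∧
    ∀ i j, (d i : ℤ) * B (Sum.inl i) j = -((d j : ℤ) * B (Sum.inl j) i)

/-- The number of arrows from `u` to `v` in the ice quiver `Γ(B)`: there are `B u j` arrows from
`u` to an exchangeable vertex `j` if `B u j > 0`, there are `-B k j` arrows from an exchangeable
vertex `j` to a frozen vertex `k` if `B k j < 0`, and there are no other arrows. -/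
def iceQuiverArrows (B : Matrix (ι ⊕ κ) ι ℤ) : ι ⊕ κ → ι ⊕ κ → ℕ
  | u, Sum.inl j => (B u j).toNat
  | Sum.inl j, Sum.inr k => (-B (Sum.inr k) j).toNat
  | Sum.inr _, Sum.inr _ => 0

/-- The exchangeable vertex `i` of `Γ(B)` is isolated: no arrow starts or ends at `i`. -/
def IsIsolated (B : Matrix (ι ⊕ κ) ι ℤ) (i : ι) : Prop :=
  ∀ v, iceQuiverArrows B (Sum.inl i) v = 0 ∧ iceQuiverArrows B v (Sum.inl i) = 0

/-- Mutation of a matrix in direction `i`. The division by `2` is exact. -/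
def mutateMatrix [DecidableEq ι] [DecidableEq κ] (B : Matrix (ι ⊕ κ) ι ℤ) (i : ι) :
    Matrix (ι ⊕ κ) ι ℤ :=
  fun j k =>
    if j = Sum.inl i ∨ k = i then -B j k
    else B j k + (|B j i| * B (Sum.inl i) k + B j i * |B (Sum.inl i) k|) / 2

end Matrices

/-- A triple `(𝐱, 𝐲, B)` in a field `F`: the elements `var (Sum.inl i)` are the exchangeable
variables `𝐱`, the elements `var (Sum.inr k)` are the frozen variables `𝐲`. -/
structure SeedData (ι κ F : Type*) where
  /-- the exchangeable and the frozen variables -/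
  var : ι ⊕ κ → F
  /-- the matrix `B` -/
  B : Matrix (ι ⊕ κ) ι ℤ

namespace SeedData

section Mutation

variable {ι κ F : Type*} [Field F]

/-- The triple `S` is a *seed* over `K` with ambient field `F`: its variables are algebraically
independent over `K`, the field `F` is the field of fractions of `K[𝐱, 𝐲]`, and `S.B` is an
exchange matrix. -/
structure IsSeed (K : Type*) [CommRing K] [Algebra K F] (S : SeedData ι κ F) : Prop where
  algebraicIndependent : AlgebraicIndependent K S.var
  isFractionRing : IsFractionRing (Algebra.adjoin K (Set.range S.var)) F
  isExchangeMatrix : IsExchangeMatrix S.B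

/-- The Laurent polynomial ring `K[u, u⁻¹ | u ∈ 𝐱 ∪ 𝐲]`, as a subalgebra of `F`. -/
def laurentRing (K : Type*) [CommRing K] [Algebra K F] (S : SeedData ι κ F) : Subalgebra K F :=
  Algebra.adjoin K (Set.range S.var ∪ Set.range (fun k => (S.var k)⁻¹))

variable [Fintype ι] [Fintype κ]

/-- The exchange polynomial `f_i = ∏_{b_ki > 0} x_k ^ b_ki + ∏_{b_ki < 0} x_k ^ (-b_ki)`, as an
element of `F`. -/
def exchangePoly (S : SeedData ι κ F) (i : ι) : F :=
  ∏ k, S.var k ^ (S.B k i).toNat + ∏ k, S.var k ^ (-S.B k i).toNat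

variable [DecidableEq ι] [DecidableEq κ]

/-- Mutation in direction `i`: `x_i` is replaced by `f_i / x_i`, the other variables are kept, and
the matrix is mutated. -/
noncomputable def mutate (S : SeedData ι κ F) (i : ι) : SeedData ι κ F where
  var := Function.update S.var (Sum.inl i) (S.exchangePoly i / S.var (Sum.inl i))
  B := mutateMatrix S.B i

/-- `T` arises from `S` by a finite (possibly empty) sequence of mutations. -/
def MutationEquiv (S T : SeedData ι κ F) : Prop :=
  Relation.ReflTransGen (fun S₁ S₂ : SeedData ι κ F => ∃ i, S₂ = S₁.mutate i) S T

/-- The set of *cluster variables*: all exchangeable variables of all triples that are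
mutation-equivalent to `S`. -/
def clusterVariables (S : SeedData ι κ F) : Set F :=
  {x | ∃ T : SeedData ι κ F, S.MutationEquiv T ∧ ∃ i, x = T.var (Sum.inl i)}

variable (K : Type*) [CommRing K] [Algebra K F]

/-- The *cluster algebra* `K[x, y, y⁻¹]`, generated by all cluster variables `x` and by
all frozen variables `y` and their inverses. -/
def clusterAlgebra (S : SeedData ι κ F) : Subalgebra K F :=
  Algebra.adjoin K
    (S.clusterVariables ∪ Set.range (fun k => S.var (Sum.inr k)) ∪
      Set.range (fun k => (S.var (Sum.inr k))⁻¹))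

/-- The *upper cluster algebra*: the intersection, over all `T` that are mutation-equivalent to
`S`, of the Laurent polynomial rings in the exchangeable and frozen variables of `T`. -/
def upperClusterAlgebra (S : SeedData ι κ F) : Subalgebra K F :=
  ⨅ T : {T : SeedData ι κ F // S.MutationEquiv T}, laurentRing K T.1

end Mutation

end SeedData

end ClusterAlg

/-! Write `ŷ_i` (`yHat`) for the Laurent monomial of column `i`. Up to a Laurent monomial, the
exchange polynomial is `1 + ŷ_i`.

Strong atoms. Let `H` lie between the cluster algebra and the upper cluster algebra, and let `x_i`
be a variable of a seed `T`. A divisor in `H` of a power of `x_i` divides a monomial in the Laurent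
ring of `T`, so it is a unit constant times a Laurent monomial. No exchangeable variable `x_j` has
negative exponent in it: in the Laurent ring of `μ_j(T)`, `x_j` is a monomial times `1 + ŷ_j`, which
is not invertible there, since it has two terms or equals `2` with `2` not a unit. Comparing
exponents, the divisor is a power of `x_i` times a unit of `H` (`IsIndepSeed.isStrongAtom`).

Laurent phenomenon. It gives the inclusion of the cluster algebra in the upper one
(`laurent_of_length_le`). For a mutation word starting `j, k`, induction makes the result Laurent in
the seeds `μ_j` and `μ_j μ_k μ_j`. The denominators over the initial seed are then powers of `1 +
ŷ_j` on one side and of two polynomials `D`, `E` on the other. These need not be coprime, so a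
frozen variable `X` is adjoined that enters only `ŷ_j`, as a factor. Then `1 + ŷ_j` is linear in
`X`, `D * E` does not vanish at its root, and the denominators cancel
(`IsIndepSeed.mem_laurentPolys`). Setting `X = 1` recovers the original seed. -/

namespace ClusterAlg

open Finset

/-! ### Laurent monomials in algebraically independent elements -/

section LaurentMonomial

variable {σ F : Type*} [Fintype σ] [Field F]

/-- The Laurent monomial `∏ x_l ^ a_l`. -/
def laurentMonomial (x : σ → F) (a : σ → ℤ) : F := ∏ l, x l ^ a l

theorem laurentMonomial_zero (x : σ → F) : laurentMonomial x 0 = 1 := by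
  simp [laurentMonomial]

theorem laurentMonomial_add {x : σ → F} (hx : ∀ l, x l ≠ 0) (a b : σ → ℤ) :
    laurentMonomial x (a + b) = laurentMonomial x a * laurentMonomial x b := by
  simp [laurentMonomial, zpow_add₀ (hx _), prod_mul_distrib]

theorem laurentMonomial_neg (x : σ → F) (a : σ → ℤ) :
    laurentMonomial x (-a) = (laurentMonomial x a)⁻¹ := by
  simp [laurentMonomial]

theorem laurentMonomial_nsmul (x : σ → F) (n : ℕ) (a : σ → ℤ) :
    laurentMonomial x (n • a) = laurentMonomial x a ^ n := by
  simp only [laurentMonomial, Pi.smul_apply, nsmul_eq_mul, ← prod_pow]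
  exact prod_congr rfl fun l _ => by rw [mul_comm, zpow_mul, zpow_natCast]

theorem laurentMonomial_ne_zero {x : σ → F} (hx : ∀ l, x l ≠ 0) (a : σ → ℤ) :
    laurentMonomial x a ≠ 0 :=
  prod_ne_zero_iff.2 fun l _ => zpow_ne_zero _ (hx l)

theorem laurentMonomial_single [DecidableEq σ] (x : σ → F) (l : σ) (n : ℤ) :
    laurentMonomial x (Pi.single l n) = x l ^ n := by
  rw [laurentMonomial, prod_eq_single l]
  · simp
  · intro k _ hk
    simp [hk]
  · simp

theorem laurentMonomial_toNat (x : σ → F) (a : σ → ℤ) :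
    ∏ l, x l ^ (a l).toNat = laurentMonomial x (fun l => max (a l) 0) :=
  prod_congr rfl fun l _ => by
    show _ = x l ^ max (a l) 0
    rw [← Int.ofNat_toNat, zpow_natCast]

theorem laurentMonomial_update [DecidableEq σ] (x : σ → F) (l : σ) (z : F) (a : σ → ℤ) :
    laurentMonomial (Function.update x l z) a =
      laurentMonomial x (Function.update a l 0) * z ^ a l := by
  rw [laurentMonomial, laurentMonomial, ← mul_prod_erase univ _ (mem_univ l),
    ← mul_prod_erase univ (fun k => x k ^ _) (mem_univ l)]
  simp only [Function.update_self, zpow_zero, one_mul]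
  rw [mul_comm]
  congr 1
  refine prod_congr rfl fun k hk => ?_
  rw [Function.update_of_ne (ne_of_mem_erase hk), Function.update_of_ne (ne_of_mem_erase hk)]

theorem laurentMonomial_update_zero [DecidableEq σ] {x : σ → F} (hx : ∀ l, x l ≠ 0) (l : σ)
    (a : σ → ℤ) :
    laurentMonomial x (Function.update a l 0) = laurentMonomial x a * (x l ^ a l)⁻¹ := by
  rw [eq_mul_inv_iff_mul_eq₀ (zpow_ne_zero _ (hx l)), ← laurentMonomial_update,
    Function.update_eq_self]

variable {K : Type*} [CommRing K] [Algebra K F]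

/-- Laurent monomials in algebraically independent elements are linearly independent. -/
theorem linearIndependent_laurentMonomial {x : σ → F} (hx : AlgebraicIndependent K x)
    (hx0 : ∀ l, x l ≠ 0) : LinearIndependent K (laurentMonomial x) := by
  classical
  rw [linearIndependent_iff']
  intro s g hg a ha
  -- Multiplying by the monomial with exponent `N` makes every exponent in `s` nonnegative, so a
  -- linear relation becomes a polynomial one.
  set N : σ → ℤ := fun l => ∑ b ∈ s, |b l| with hN
  have hpos : ∀ b ∈ s, ∀ l, 0 ≤ b l + N l := fun b hb l => by
    have := single_le_sum (f := fun b : σ → ℤ => |b l|) (fun _ _ => abs_nonneg _) hb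
    have := neg_abs_le (b l)
    simp only [hN]
    linarith
  set e : (σ → ℤ) → σ →₀ ℕ := fun b => Finsupp.equivFunOnFinite.symm fun l => (b l + N l).toNat
    with he
  have hmon : ∀ b ∈ s, MvPolynomial.aeval x (MvPolynomial.monomial (e b) (g b)) =
      laurentMonomial x N * (g b • laurentMonomial x b) := fun b hb => by
    rw [MvPolynomial.aeval_monomial, Algebra.smul_def, mul_left_comm, ← laurentMonomial_add hx0,
      Finsupp.prod_fintype _ _ (fun _ => pow_zero _), laurentMonomial]
    congr 1
    refine prod_congr rfl fun l _ => ?_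
    rw [← zpow_natCast]
    congr 1
    simp [he, hpos b hb l, add_comm]
  have h0 : ∑ b ∈ s, MvPolynomial.monomial (e b) (g b) = 0 := by
    apply (algebraicIndependent_iff_injective_aeval.1 hx)
    rw [map_sum, sum_congr rfl hmon, ← mul_sum, hg, mul_zero, map_zero]
  have h1 := congrArg (MvPolynomial.coeff (e a)) h0
  rw [MvPolynomial.coeff_sum, sum_eq_single a] at h1
  · simpa using h1
  · intro b hb hba
    rw [MvPolynomial.coeff_monomial, if_neg]
    intro h
    apply hba
    ext l
    have := DFunLike.congr_fun h l
    simp only [he, Finsupp.equivFunOnFinite_symm_apply_apply] at this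
    have := hpos b hb l
    have := hpos a ha l
    omega
  · exact fun h => absurd ha h

theorem laurentMonomial_ne_algebraMap {x : σ → F} (hx : AlgebraicIndependent K x)
    (hx0 : ∀ l, x l ≠ 0) [Nontrivial K] {a : σ → ℤ} (ha : a ≠ 0) (c : K) :
    laurentMonomial x a ≠ algebraMap K F c := by
  intro h
  have h1 : Finsupp.linearCombination K (laurentMonomial x) (Finsupp.single a 1) =
      Finsupp.linearCombination K (laurentMonomial x) (Finsupp.single 0 c) := by
    simp [laurentMonomial_zero, h, Algebra.smul_def]
  have h2 := DFunLike.congr_fun (linearIndependent_laurentMonomial hx hx0 h1) a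
  simp [ha.symm] at h2

theorem one_add_laurentMonomial_ne {x : σ → F} (hx : AlgebraicIndependent K x)
    (hx0 : ∀ l, x l ≠ 0) [Nontrivial K] {a : σ → ℤ} (ha : a ≠ 0) (c : K) (e : σ → ℤ) :
    1 + laurentMonomial x a ≠ c • laurentMonomial x e := by
  intro h
  have h1 : Finsupp.linearCombination K (laurentMonomial x)
      (Finsupp.single 0 1 + Finsupp.single a 1) =
      Finsupp.linearCombination K (laurentMonomial x) (Finsupp.single e c) := by
    simp [laurentMonomial_zero, ← h]
  have h2 := linearIndependent_laurentMonomial hx hx0 h1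
  have h3 := DFunLike.congr_fun h2 a
  have h4 := DFunLike.congr_fun h2 0
  by_cases he : e = 0
  · subst he
    simp [ha] at h3
  · simp [ha, Ne.symm he] at h4

end LaurentMonomial

/-! ### Matrix mutation -/

section Matrices

variable {ι κ : Type*}

theorem IsExchangeMatrix.diag {B : Matrix (ι ⊕ κ) ι ℤ} (hB : IsExchangeMatrix B) (i : ι) :
    B (Sum.inl i) i = 0 := by
  obtain ⟨d, hd, h⟩ := hB
  have h1 := h i i
  have h2 : (d i : ℤ) ≠ 0 := by exact_mod_cast (hd i).ne'
  have : (d i : ℤ) * B (Sum.inl i) i = 0 := by linarith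
  exact (mul_eq_zero.1 this).resolve_left h2

theorem IsExchangeMatrix.neg {B : Matrix (ι ⊕ κ) ι ℤ} (hB : IsExchangeMatrix B) :
    IsExchangeMatrix (-B) := by
  obtain ⟨d, hd, h⟩ := hB
  exact ⟨d, hd, fun i j => by have := h i j; simp only [Matrix.neg_apply]; linarith⟩

theorem IsExchangeMatrix.nonpos {B : Matrix (ι ⊕ κ) ι ℤ} (hB : IsExchangeMatrix B) {i j : ι}
    (h : 0 ≤ B (Sum.inl i) j) : B (Sum.inl j) i ≤ 0 := by
  obtain ⟨d, hd, hs⟩ := hB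
  have h1 := hs i j
  have h2 : (0 : ℤ) < d j := by exact_mod_cast hd j
  have h3 : (0 : ℤ) < d i := by exact_mod_cast hd i
  nlinarith [mul_nonneg h3.le h]

theorem IsExchangeMatrix.eq_zero {B : Matrix (ι ⊕ κ) ι ℤ} (hB : IsExchangeMatrix B) {i j : ι}
    (h : B (Sum.inl i) j = 0) : B (Sum.inl j) i = 0 := by
  refine le_antisymm (hB.nonpos h.ge) ?_
  have := hB.neg.nonpos (i := i) (j := j) (by simp [h])
  simpa using this

/-- The correction term of matrix mutation. -/
theorem abs_mul_add_mul_abs_div_two (a b : ℤ) :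
    (|a| * b + a * |b|) / 2 = max a 0 * max b 0 - max (-a) 0 * max (-b) 0 := by
  rcases le_total 0 a with ha | ha <;> rcases le_total 0 b with hb | hb <;>
    simp only [abs_of_nonneg, abs_of_nonpos, max_eq_left, max_eq_right, ha, hb, neg_nonneg,
      neg_nonpos] <;> ring_nf <;> omega

variable [DecidableEq ι] [DecidableEq κ]

/-- The form with positive and negative parts removes the division by `2`, so later identities
follow by ring arithmetic. -/
theorem mutateMatrix_apply_of_ne (B : Matrix (ι ⊕ κ) ι ℤ) {i k : ι} {l : ι ⊕ κ}
    (hl : l ≠ Sum.inl i) (hk : k ≠ i) : mutateMatrix B i l k = B l k +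
      (max (B l i) 0 * max (B (Sum.inl i) k) 0 - max (-B l i) 0 * max (-B (Sum.inl i) k) 0) := by
  rw [mutateMatrix, if_neg (by tauto), abs_mul_add_mul_abs_div_two]

theorem mutateMatrix_row (B : Matrix (ι ⊕ κ) ι ℤ) (i k : ι) :
    mutateMatrix B i (Sum.inl i) k = -B (Sum.inl i) k := by simp [mutateMatrix]

theorem mutateMatrix_col (B : Matrix (ι ⊕ κ) ι ℤ) (i : ι) (l : ι ⊕ κ) :
    mutateMatrix B i l i = -B l i := by simp [mutateMatrix]

theorem mutateMatrix_neg (B : Matrix (ι ⊕ κ) ι ℤ) (i : ι) :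
    mutateMatrix (-B) i = -mutateMatrix B i := by
  ext l k
  by_cases hl : l = Sum.inl i
  · simp [hl, mutateMatrix_row]
  by_cases hk : k = i
  · simp [hk, mutateMatrix_col]
  simp only [mutateMatrix_apply_of_ne _ hl hk, Matrix.neg_apply, neg_neg]
  ring

theorem mutateMatrix_mutateMatrix (B : Matrix (ι ⊕ κ) ι ℤ) (i : ι) :
    mutateMatrix (mutateMatrix B i) i = B := by
  ext l k
  by_cases hl : l = Sum.inl i
  · simp [hl, mutateMatrix_row]
  by_cases hk : k = i
  · simp [hk, mutateMatrix_col]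
  simp only [mutateMatrix_apply_of_ne _ hl hk, mutateMatrix_row, mutateMatrix_col, neg_neg]
  ring

theorem IsExchangeMatrix.mutateMatrix {B : Matrix (ι ⊕ κ) ι ℤ} (hB : IsExchangeMatrix B) (i : ι) :
    IsExchangeMatrix (mutateMatrix B i) := by
  obtain ⟨d, hd, h⟩ := hB
  refine ⟨d, hd, fun j k => ?_⟩
  by_cases hj : j = i
  · subst hj
    simp only [mutateMatrix_row, mutateMatrix_col]
    linarith [h j k]
  by_cases hk : k = i
  · subst hk
    simp only [mutateMatrix_row, mutateMatrix_col]
    linarith [h j k]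
  have hinj : ∀ {a b : ι}, a ≠ b → (Sum.inl a : ι ⊕ κ) ≠ Sum.inl b := fun h h' =>
    h (Sum.inl_injective h')
  rw [mutateMatrix_apply_of_ne _ (hinj hj) hk, mutateMatrix_apply_of_ne _ (hinj hk) hj]
  have hmul : ∀ (n : ℕ) (a : ℤ), max ((n : ℤ) * a) 0 = n * max a 0 := fun n a => by
    rw [mul_max_of_nonneg _ _ (Int.natCast_nonneg n), mul_zero]
  -- Skew-symmetrizability exchanges positive parts of column `i` with negative parts of row `i`.
  have key : ∀ a : ι, (d a : ℤ) * max (B (Sum.inl a) i) 0 = d i * max (-B (Sum.inl i) a) 0 ∧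
      (d a : ℤ) * max (-B (Sum.inl a) i) 0 = d i * max (B (Sum.inl i) a) 0 := fun a => by
    simp only [← hmul, mul_neg]
    rw [h a i, neg_neg]
    exact ⟨rfl, rfl⟩
  linear_combination h j k + max (B (Sum.inl i) k) 0 * (key j).1 -
    max (-B (Sum.inl i) k) 0 * (key j).2 + max (B (Sum.inl i) j) 0 * (key k).1 -
    max (-B (Sum.inl i) j) 0 * (key k).2

end Matrices

/-! ### Mutation of variables and of the monomials `ŷ` -/

namespace SeedData

variable {ι κ F : Type*} [Field F] [Fintype ι] [Fintype κ]

/-- The Laurent monomial `∏ x_k ^ b_ki` given by the column `i` of the matrix of a seed. -/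
def yHat (S : SeedData ι κ F) (i : ι) : F := laurentMonomial S.var fun l => S.B l i

theorem exchangePoly_eq {S : SeedData ι κ F} (h0 : ∀ l, S.var l ≠ 0) (i : ι) :
    S.exchangePoly i = laurentMonomial S.var (fun l => max (-S.B l i) 0) * (1 + S.yHat i) := by
  rw [exchangePoly, laurentMonomial_toNat, laurentMonomial_toNat, mul_add, mul_one, yHat,
    ← laurentMonomial_add h0, add_comm]
  congr 2
  ext l
  simp only [Pi.add_apply]
  omega

theorem exchangePoly_eq_yHat_mul {S : SeedData ι κ F} (h0 : ∀ l, S.var l ≠ 0) (i : ι) :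
    S.exchangePoly i * S.yHat i =
      laurentMonomial S.var (fun l => max (S.B l i) 0) * (1 + S.yHat i) := by
  rw [exchangePoly_eq h0, mul_right_comm]
  congr 1
  rw [yHat, ← laurentMonomial_add h0]
  congr 1
  ext l
  simp only [Pi.add_apply]
  omega

variable [DecidableEq ι] [DecidableEq κ]

theorem mutate_var_self (S : SeedData ι κ F) (i : ι) :
    (S.mutate i).var (Sum.inl i) = S.exchangePoly i / S.var (Sum.inl i) := by
  simp [mutate]

theorem mutate_var_of_ne (S : SeedData ι κ F) {i : ι} {l : ι ⊕ κ} (h : l ≠ Sum.inl i) :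
    (S.mutate i).var l = S.var l := by
  simp [mutate, h]

theorem laurentMonomial_mutate (S : SeedData ι κ F) (i : ι) (a : ι ⊕ κ → ℤ) :
    laurentMonomial (S.mutate i).var a = laurentMonomial S.var (Function.update a (Sum.inl i) 0) *
      (S.mutate i).var (Sum.inl i) ^ a (Sum.inl i) := by
  rw [mutate_var_self]
  exact laurentMonomial_update ..

theorem laurentMonomial_mutate_of_eq_zero (S : SeedData ι κ F) {i : ι} {a : ι ⊕ κ → ℤ}
    (h : a (Sum.inl i) = 0) : laurentMonomial (S.mutate i).var a = laurentMonomial S.var a := by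
  rw [laurentMonomial_mutate, h, zpow_zero, mul_one, ← h, Function.update_eq_self]

theorem mutate_exchangePoly_self {S : SeedData ι κ F} (hB : IsExchangeMatrix S.B) (i : ι) :
    (S.mutate i).exchangePoly i = S.exchangePoly i := by
  simp only [exchangePoly]
  rw [laurentMonomial_toNat, laurentMonomial_toNat, laurentMonomial_toNat, laurentMonomial_toNat,
    laurentMonomial_mutate_of_eq_zero, laurentMonomial_mutate_of_eq_zero, add_comm]
  · simp [mutate, mutateMatrix_col]
  · simp [mutate, mutateMatrix_col, hB.diag]
  · simp [mutate, mutateMatrix_col, hB.diag]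

/-- As `b_ii = 0`, the polynomial `f_i` does not involve `x_i` and survives the mutation, so `x_i`
returns as `f_i / (f_i / x_i)`. -/
theorem mutate_mutate {S : SeedData ι κ F} (hB : IsExchangeMatrix S.B) {i : ι}
    (h : S.exchangePoly i ≠ 0) : (S.mutate i).mutate i = S := by
  have h1 : ((S.mutate i).mutate i).var = S.var := by
    ext l
    by_cases hl : l = Sum.inl i
    · rw [hl, mutate_var_self, mutate_exchangePoly_self hB, mutate_var_self, div_div_cancel₀ h]
    · rw [mutate_var_of_ne _ hl, mutate_var_of_ne _ hl]
  have h2 : ((S.mutate i).mutate i).B = S.B := mutateMatrix_mutateMatrix ..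
  cases S
  exact congrArg₂ SeedData.mk h1 h2

theorem mutate_yHat_self {S : SeedData ι κ F} (hB : IsExchangeMatrix S.B) (i : ι) :
    (S.mutate i).yHat i = (S.yHat i)⁻¹ := by
  rw [yHat, laurentMonomial_mutate_of_eq_zero, yHat, ← laurentMonomial_neg]
  · congr 1
    ext l
    simp [mutate, mutateMatrix_col]
  · simp [mutate, mutateMatrix_col, hB.diag]

/-- Off row `i`, column `k` gains `b` times the positive part of column `i`, which contributes `M ^
b`. Replacing `x_i ^ b` by `(f_i / x_i) ^ (-b)` contributes `f_i ^ (-b)`, and `M / f_i = ŷ_i / (1 +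
ŷ_i)`. -/
theorem mutate_yHat_of_nonneg {S : SeedData ι κ F} (hB : IsExchangeMatrix S.B)
    (h0 : ∀ l, S.var l ≠ 0) {i k : ι} (hik : k ≠ i) {b : ℕ} (hb : S.B (Sum.inl i) k = b)
    (hp : 1 + S.yHat i ≠ 0) :
    (S.mutate i).yHat k = S.yHat k * (S.yHat i / (1 + S.yHat i)) ^ b := by
  set M := laurentMonomial S.var fun l => max (S.B l i) 0 with hM
  have hM0 : M ≠ 0 := laurentMonomial_ne_zero h0 _
  have hy0 : S.yHat i ≠ 0 := laurentMonomial_ne_zero h0 _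
  have hf := exchangePoly_eq_yHat_mul h0 i
  rw [← hM] at hf
  have hf' : S.exchangePoly i = M * (1 + S.yHat i) / S.yHat i := by
    rw [eq_div_iff hy0, hf]
  have hcol : Function.update (fun l => (S.mutate i).B l k) (Sum.inl i) 0 =
      Function.update (fun l => S.B l k) (Sum.inl i) 0 + b • fun l => max (S.B l i) 0 := by
    ext l
    by_cases hl : l = Sum.inl i
    · simp [hl, hB.diag]
    · simp [hl, mutate, mutateMatrix_apply_of_ne _ hl hik, hb, mul_comm]
  rw [yHat, laurentMonomial_mutate, hcol, laurentMonomial_add h0, laurentMonomial_nsmul, ← hM,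
    laurentMonomial_update_zero h0]
  have h1 : (S.mutate i).B (Sum.inl i) k = -(b : ℤ) := by
    simp [mutate, mutateMatrix_row, hb]
  rw [h1, hb, mutate_var_self, hf', zpow_neg, zpow_natCast, zpow_natCast, ← yHat]
  have hx := h0 (Sum.inl i)
  rw [← inv_pow, ← inv_pow, mul_assoc, mul_assoc, ← mul_pow, ← mul_pow]
  congr 2
  field_simp

/-- Algebraic independence of the variables is preserved by mutation. -/
theorem algebraicIndependent_mutate {K : Type*} [CommRing K] [Algebra K F] {S : SeedData ι κ F}
    (hS : AlgebraicIndependent K S.var) (hB : IsExchangeMatrix S.B) {i : ι}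
    (hf : S.exchangePoly i ≠ 0) : AlgebraicIndependent K (S.mutate i).var := by
  have hinj := hS.algebraMap_injective
  have : IsDomain K := hinj.isDomain _
  rw [AlgebraicIndependent.iff_transcendental_adjoin_image (Sum.inl i)] at hS ⊢
  obtain ⟨h1, h2⟩ := hS
  have heq : ∀ l ∈ ({Sum.inl i}ᶜ : Set (ι ⊕ κ)), (S.mutate i).var l = S.var l :=
    fun l hl => mutate_var_of_ne S hl
  rw [Set.image_congr heq]
  refine ⟨?_, fun h => h2 ?_⟩
  · convert h1 using 2 with l
    exact heq l l.2
  set s : Set (ι ⊕ κ) := {Sum.inl i}ᶜ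
  have hmem : S.exchangePoly i ∈ Algebra.adjoin K (S.var '' s) := by
    have : ∀ e : ι ⊕ κ → ℕ, e (Sum.inl i) = 0 →
        ∏ l, S.var l ^ e l ∈ Algebra.adjoin K (S.var '' s) := fun e he => by
      refine Subalgebra.prod_mem _ fun l _ => ?_
      by_cases hl : l = Sum.inl i
      · rw [hl, he, pow_zero]
        exact one_mem _
      · exact pow_mem (Algebra.subset_adjoin (Set.mem_image_of_mem _ hl)) _
    exact add_mem (this (fun l => (S.B l i).toNat) (by simp [hB.diag]))
      (this (fun l => (-S.B l i).toNat) (by simp [hB.diag]))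
  have h3 : IsAlgebraic (Algebra.adjoin K (S.var '' s)) (S.exchangePoly i) :=
    isAlgebraic_algebraMap (⟨S.exchangePoly i, hmem⟩ : Algebra.adjoin K (S.var '' s))
  rw [mutate_var_self] at h
  -- If `f_i / x_i` were algebraic over the other variables, so would be `x_i = f_i * (f_i /
  -- x_i)⁻¹`.
  have h4 := h3.mul h.inv
  rwa [inv_div, mul_div_cancel₀ _ hf] at h4

end SeedData

end ClusterAlg

namespace ClusterAlg

open Finset

/-! ### Laurent rings, and the variables after one, two and three mutations -/

/-- `g` is a Laurent monomial in the elements `x`. -/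
def IsLaurentMonomial {σ F : Type*} [Fintype σ] [Field F] (x : σ → F) (g : F) : Prop :=
  ∃ a : σ → ℤ, laurentMonomial x a = g

namespace IsLaurentMonomial

variable {σ F : Type*} [Fintype σ] [Field F] {x : σ → F} {g h : F}

theorem var (x : σ → F) (l : σ) : IsLaurentMonomial x (x l) := by
  classical
  exact ⟨Pi.single l 1, by rw [laurentMonomial_single, zpow_one]⟩

theorem mul (hx : ∀ l, x l ≠ 0) (hg : IsLaurentMonomial x g) (hh : IsLaurentMonomial x h) :
    IsLaurentMonomial x (g * h) := by
  obtain ⟨a, rfl⟩ := hg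
  obtain ⟨b, rfl⟩ := hh
  exact ⟨a + b, laurentMonomial_add hx a b⟩

theorem inv (hg : IsLaurentMonomial x g) : IsLaurentMonomial x g⁻¹ := by
  obtain ⟨a, rfl⟩ := hg
  exact ⟨-a, laurentMonomial_neg x a⟩

theorem pow (hg : IsLaurentMonomial x g) (n : ℕ) : IsLaurentMonomial x (g ^ n) := by
  obtain ⟨a, rfl⟩ := hg
  exact ⟨n • a, laurentMonomial_nsmul x n a⟩

theorem ne_zero (hx : ∀ l, x l ≠ 0) (hg : IsLaurentMonomial x g) : g ≠ 0 := by
  obtain ⟨a, rfl⟩ := hg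
  exact laurentMonomial_ne_zero hx a

end IsLaurentMonomial

namespace SeedData

section LaurentRing

variable {ι κ F K : Type*} [Field F] [CommRing K] [Algebra K F]

theorem var_mem_laurentRing (S : SeedData ι κ F) (l : ι ⊕ κ) : S.var l ∈ S.laurentRing K :=
  Algebra.subset_adjoin (Or.inl ⟨l, rfl⟩)

theorem inv_var_mem_laurentRing (S : SeedData ι κ F) (l : ι ⊕ κ) :
    (S.var l)⁻¹ ∈ S.laurentRing K :=
  Algebra.subset_adjoin (Or.inr ⟨l, rfl⟩)

theorem laurentMonomial_mem_laurentRing [Fintype ι] [Fintype κ] (S : SeedData ι κ F)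
    (a : ι ⊕ κ → ℤ) : laurentMonomial S.var a ∈ S.laurentRing K := by
  refine Subalgebra.prod_mem _ fun l _ => ?_
  obtain ⟨n, hn | hn⟩ := (a l).eq_nat_or_neg
  · rw [hn, zpow_natCast]
    exact pow_mem (S.var_mem_laurentRing l) n
  · rw [hn, zpow_neg, zpow_natCast, ← inv_pow]
    exact pow_mem (S.inv_var_mem_laurentRing l) n

theorem _root_.ClusterAlg.IsLaurentMonomial.mem_laurentRing [Fintype ι] [Fintype κ]
    {S : SeedData ι κ F} {g : F} (hg : IsLaurentMonomial S.var g) : g ∈ S.laurentRing K := by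
  obtain ⟨a, rfl⟩ := hg
  exact S.laurentMonomial_mem_laurentRing a

/-- If the variables of `T` and their inverses times `w` lie in `A ∋ w`, then `w` is a common
denominator, up to powers, for the Laurent ring of `T` over `A`. -/
theorem exists_mul_pow_mem {T : SeedData ι κ F} {A : Subalgebra K F} {w : F} (hw : w ∈ A)
    (h1 : ∀ l, T.var l ∈ A) (h2 : ∀ l, (T.var l)⁻¹ * w ∈ A) {g : F} (hg : g ∈ T.laurentRing K) :
    ∃ a : ℕ, g * w ^ a ∈ A := by
  induction hg using Algebra.adjoin_induction with
  | mem g hg =>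
    rcases hg with ⟨l, rfl⟩ | ⟨l, rfl⟩
    · exact ⟨0, by simpa using h1 l⟩
    · exact ⟨1, by simpa using h2 l⟩
  | algebraMap r => exact ⟨0, by simp⟩
  | add g h _ _ hg hh =>
    obtain ⟨a, ha⟩ := hg
    obtain ⟨b, hb⟩ := hh
    refine ⟨a + b, ?_⟩
    have : (g + h) * w ^ (a + b) = g * w ^ a * w ^ b + h * w ^ b * w ^ a := by ring
    rw [this]
    exact add_mem (mul_mem ha (pow_mem hw _)) (mul_mem hb (pow_mem hw _))
  | mul g h _ _ hg hh =>
    obtain ⟨a, ha⟩ := hg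
    obtain ⟨b, hb⟩ := hh
    refine ⟨a + b, ?_⟩
    have : (g * h) * w ^ (a + b) = g * w ^ a * (h * w ^ b) := by ring
    rw [this]
    exact mul_mem ha hb

end LaurentRing

variable {ι κ F : Type*} [Field F]

/-- The variables are algebraically independent over `K`, and the matrix is an exchange matrix. -/
structure IsIndepSeed (K : Type*) [CommRing K] [Algebra K F] (S : SeedData ι κ F) : Prop where
  indep : AlgebraicIndependent K S.var
  exch : IsExchangeMatrix S.B

namespace IsIndepSeed

variable {K : Type*} [CommRing K] [CharZero K] [Algebra K F] {S : SeedData ι κ F}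

theorem var_ne_zero (hS : S.IsIndepSeed K) (l : ι ⊕ κ) : S.var l ≠ 0 := hS.indep.ne_zero l

variable [Fintype ι] [Fintype κ]

theorem yHat_ne_zero (hS : S.IsIndepSeed K) (i : ι) : S.yHat i ≠ 0 :=
  laurentMonomial_ne_zero hS.var_ne_zero _

theorem yHat_ne_algebraMap (hS : S.IsIndepSeed K) {l : ι ⊕ κ} {i : ι} (h : S.B l i ≠ 0) (c : K) :
    S.yHat i ≠ algebraMap K F c :=
  laurentMonomial_ne_algebraMap hS.indep hS.var_ne_zero (fun h' => h (congrFun h' l)) c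

/-- For a zero column the sum is `2`, nonzero in characteristic zero; otherwise `ŷ_i` is a
nontrivial monomial and cannot be `-1`. -/
theorem one_add_yHat_ne_zero (hS : S.IsIndepSeed K) (i : ι) : 1 + S.yHat i ≠ 0 := by
  have : CharZero F := charZero_of_injective_algebraMap hS.indep.algebraMap_injective
  intro h
  by_cases h0 : ∀ l, S.B l i = 0
  · have h1 : S.yHat i = 1 := by simp [yHat, laurentMonomial, h0]
    rw [h1] at h
    norm_num at h
  · push Not at h0
    obtain ⟨l, hl⟩ := h0
    refine hS.yHat_ne_algebraMap hl (-1) ?_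
    rw [map_neg, map_one]
    linear_combination h

theorem exchangePoly_ne_zero (hS : S.IsIndepSeed K) (i : ι) : S.exchangePoly i ≠ 0 := by
  rw [exchangePoly_eq hS.var_ne_zero]
  exact mul_ne_zero (laurentMonomial_ne_zero hS.var_ne_zero _) (hS.one_add_yHat_ne_zero i)

variable [DecidableEq ι] [DecidableEq κ]

theorem mutate (hS : S.IsIndepSeed K) (i : ι) : (S.mutate i).IsIndepSeed K :=
  ⟨algebraicIndependent_mutate hS.indep hS.exch (hS.exchangePoly_ne_zero i),
    hS.exch.mutateMatrix i⟩

theorem mutate_mutate (hS : S.IsIndepSeed K) (i : ι) : (S.mutate i).mutate i = S :=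
  SeedData.mutate_mutate hS.exch (hS.exchangePoly_ne_zero i)

/-- Laurent monomials are units of the Laurent ring, so here and below new variables are needed only
up to such a factor. -/
theorem mutate_var_self (hS : S.IsIndepSeed K) (i : ι) : ∃ m, IsLaurentMonomial S.var m ∧
    (S.mutate i).var (Sum.inl i) = m * (1 + S.yHat i) := by
  refine ⟨_, IsLaurentMonomial.mul hS.var_ne_zero ⟨fun l => max (-S.B l i) 0, rfl⟩
    (IsLaurentMonomial.var _ (Sum.inl i)).inv, ?_⟩
  rw [SeedData.mutate_var_self, exchangePoly_eq hS.var_ne_zero]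
  ring

theorem mutate_mutate_var (hS : S.IsIndepSeed K) {j k : ι} (hjk : k ≠ j) {b : ℕ}
    (hb : S.B (Sum.inl j) k = b) : ∃ m, IsLaurentMonomial S.var m ∧
    ((S.mutate j).mutate k).var (Sum.inl k) =
      m * ((1 + S.yHat j) ^ b + S.yHat k * S.yHat j ^ b) := by
  have hT := hS.mutate j
  obtain ⟨m, hm, hz⟩ := hS.mutate_var_self j
  have hB : (S.mutate j).B (Sum.inl j) k = -(b : ℤ) := by
    simp [SeedData.mutate, mutateMatrix_row, hb]
  refine ⟨_, ((IsLaurentMonomial.mul hS.var_ne_zero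
    ⟨Function.update (fun l => max (-(S.mutate j).B l k) 0) (Sum.inl j) 0, rfl⟩ (hm.pow b)).mul
    hS.var_ne_zero (IsLaurentMonomial.var _ (Sum.inl k)).inv), ?_⟩
  have hp := hS.one_add_yHat_ne_zero j
  rw [SeedData.mutate_var_self, exchangePoly_eq hT.var_ne_zero, laurentMonomial_mutate, hz,
    mutate_yHat_of_nonneg hS.exch hS.var_ne_zero hjk hb hp,
    mutate_var_of_ne _ (by simpa using hjk), hB, neg_neg, max_eq_left (Int.natCast_nonneg b),
    zpow_natCast, div_pow]
  have hx := hS.var_ne_zero (Sum.inl k)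
  field_simp
  rw [mul_pow]
  ring

/-- The factor `1 + ŷ_j` stays on the left; that it divides the right side is the content of
`one_add_mul_tripleNumerator`. -/
theorem mutate_mutate_mutate_var (hS : S.IsIndepSeed K) {j k : ι} (hjk : k ≠ j) {b c : ℕ}
    (hb : S.B (Sum.inl j) k = b) (hc : S.B (Sum.inl k) j = -c) :
    ∃ m, IsLaurentMonomial S.var m ∧
    (1 + S.yHat j) * (((S.mutate j).mutate k).mutate j).var (Sum.inl j) =
      m * (S.yHat j * ((1 + S.yHat j) ^ b + S.yHat k * S.yHat j ^ b) ^ c +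
        (S.yHat k * S.yHat j ^ b) ^ c) := by
  have hT := hS.mutate j
  have hT2 := hT.mutate k
  have hp := hS.one_add_yHat_ne_zero j
  have hp0 := hS.yHat_ne_zero j
  have hq := hT.one_add_yHat_ne_zero k
  obtain ⟨m, hm, hz⟩ := hS.mutate_var_self j
  obtain ⟨n, hn, hu⟩ := hS.mutate_mutate_var hjk hb
  have hcT : (S.mutate j).B (Sum.inl k) j = c := by
    simp [SeedData.mutate, mutateMatrix_col, hc]
  have hcT2 : ((S.mutate j).mutate k).B (Sum.inl k) j = -(c : ℤ) := by
    rw [← hcT]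
    exact mutateMatrix_row _ _ _
  have hj : (Sum.inl j : ι ⊕ κ) ≠ Sum.inl k := fun h => hjk (Sum.inl_injective h).symm
  have hmono : laurentMonomial ((S.mutate j).mutate k).var
      (fun l => max (-((S.mutate j).mutate k).B l j) 0) = laurentMonomial S.var
        (Function.update (fun l => max (-((S.mutate j).mutate k).B l j) 0) (Sum.inl k) 0) *
      ((S.mutate j).mutate k).var (Sum.inl k) ^ c := by
    rw [laurentMonomial_mutate, laurentMonomial_mutate_of_eq_zero, hcT2, neg_neg,
      max_eq_left (Int.natCast_nonneg c), zpow_natCast]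
    rw [Function.update_of_ne hj, hT2.exch.diag]
    rfl
  set a := laurentMonomial S.var
    (Function.update (fun l => max (-((S.mutate j).mutate k).B l j) 0) (Sum.inl k) 0) with ha
  have hm0 := hm.ne_zero hS.var_ne_zero
  refine ⟨a * n ^ c * m⁻¹ * (S.yHat j)⁻¹, (((IsLaurentMonomial.mul hS.var_ne_zero ⟨_, ha.symm⟩
    (hn.pow c)).mul hS.var_ne_zero hm.inv).mul hS.var_ne_zero (IsLaurentMonomial.inv ⟨_, rfl⟩)), ?_⟩
  have hqT := mutate_yHat_of_nonneg hS.exch hS.var_ne_zero hjk hb hp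
  have hD : (1 + S.yHat j) ^ b + S.yHat k * S.yHat j ^ b =
      (1 + S.yHat j) ^ b * (1 + (S.mutate j).yHat k) := by
    rw [hqT, div_pow]
    field_simp
  have hw : S.yHat k * S.yHat j ^ b = (1 + S.yHat j) ^ b * (S.mutate j).yHat k := by
    rw [hqT, div_pow]
    field_simp
  rw [SeedData.mutate_var_self, exchangePoly_eq hT2.var_ne_zero, hmono, hu,
    mutate_yHat_of_nonneg hT.exch hT.var_ne_zero hjk.symm hcT hq, mutate_yHat_self hS.exch,
    mutate_var_of_ne _ hj, hz, hD, hw]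
  set r := (S.mutate j).yHat k
  set p := S.yHat j
  rw [div_pow, mul_pow, mul_pow, mul_pow]
  field_simp

end IsIndepSeed

end SeedData

/-! ### The numerator after three mutations -/

section ThreeMutations

variable {R : Type*} [CommRing R]

/-- The numerator of the variable obtained by three mutations in directions `j, k, j`. -/
def tripleNumerator (b c : ℕ) (p q : R) : R :=
  if b = 0 then 1 else
    p * (1 + p) ^ (b - 1) *
      (∑ i ∈ range c, ((1 + p) ^ b + q * p ^ b) ^ i * (q * p ^ b) ^ (c - 1 - i)) +
      (q * p ^ b) ^ c

/-- With `w = q * p ^ b` and `D = (1 + p) ^ b + w`, the right side is `p * (D ^ c - w ^ c) + (1 + p)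
* w ^ c`, and the geometric sum factors `D - w = (1 + p) ^ b` out of the difference. For `b = 0`
also `c = 0`, and the right side is `p + 1`. -/
theorem one_add_mul_tripleNumerator {b c : ℕ} (h : b = 0 → c = 0) (p q : R) :
    (1 + p) * tripleNumerator b c p q =
      p * ((1 + p) ^ b + q * p ^ b) ^ c + (q * p ^ b) ^ c := by
  rw [tripleNumerator]
  split_ifs with hb
  · simp [h hb, add_comm]
  · obtain ⟨b, rfl⟩ := Nat.exists_eq_succ_of_ne_zero hb
    have h1 := geom_sum₂_mul ((1 + p) ^ (b + 1) + q * p ^ (b + 1)) (q * p ^ (b + 1)) c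
    simp only [Nat.succ_eq_add_one, Nat.add_sub_cancel]
    simp only [add_sub_cancel_right] at h1
    linear_combination p * h1

theorem map_tripleNumerator {R' : Type*} [CommRing R'] (f : R →+* R') (b c : ℕ) (p q : R) :
    f (tripleNumerator b c p q) = tripleNumerator b c (f p) (f q) := by
  unfold tripleNumerator
  split_ifs <;> simp

/-- For `b ≥ 2` only `(q * p ^ b) ^ c` survives at `p = -1`. For `b = 1` and `c ≥ 1` the geometric
sum has `c` equal terms and the value is `-(-q) ^ (c - 1) * (q + c)`, whence the condition `q ≠ -c`.
-/
theorem tripleNumerator_neg_one_ne_zero {F : Type*} [Field F] {b c : ℕ} {q : F} (hq : q ≠ 0)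
    (hqc : q ≠ -c) : tripleNumerator b c (-1) q ≠ 0 := by
  rw [tripleNumerator]
  split_ifs with hb
  · exact one_ne_zero
  · obtain ⟨b, rfl⟩ := Nat.exists_eq_succ_of_ne_zero hb
    simp only [Nat.succ_eq_add_one, Nat.add_sub_cancel, add_neg_cancel]
    rcases b with _ | b
    · rcases c with _ | c
      · simp
      have : ∀ i ∈ range (c + 1), (0 ^ (0 + 1) + q * (-1) ^ (0 + 1)) ^ i *
          (q * (-1) ^ (0 + 1)) ^ (c + 1 - 1 - i) = (-q) ^ c := fun i hi => by
        have : i + (c + 1 - 1 - i) = c := by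
          have := mem_range.1 hi
          omega
        simp only [zero_add, pow_one, mul_neg, mul_one, ← pow_add, this]
      rw [sum_congr rfl this, sum_const, card_range]
      have h1 : (-1 * 0 ^ 0 * (c + 1) • (-q) ^ c + (q * (-1) ^ (0 + 1)) ^ (c + 1) : F) =
          (-q) ^ c * (-(q + (c + 1 : ℕ))) := by
        simp only [nsmul_eq_mul]
        ring
      rw [h1]
      exact mul_ne_zero (pow_ne_zero _ (neg_ne_zero.2 hq))
        (neg_ne_zero.2 fun h => hqc (eq_neg_of_add_eq_zero_left h))
    · simpa using fun h => absurd h hq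

end ThreeMutations

end ClusterAlg

namespace ClusterAlg

open Finset Polynomial

/-! ### Laurent polynomials in one variable and their value at `1` -/

section LaurentPolynomials

variable {K F : Type*} [CommRing K] [Field F] [Algebra K F] (A : Subalgebra K F)

/-- The embedding of the polynomials over the subring `A` of `F` into the rational functions. -/
noncomputable def polyToRatFunc : A[X] →+* RatFunc F :=
  (algebraMap F[X] (RatFunc F)).comp (Polynomial.mapRingHom A.val.toRingHom)

theorem polyToRatFunc_injective : Function.Injective (polyToRatFunc A) :=
  (RatFunc.algebraMap_injective F).comp (Polynomial.map_injective _ Subtype.val_injective)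

@[simp] theorem polyToRatFunc_X : polyToRatFunc A X = RatFunc.X := by
  simp [polyToRatFunc]

@[simp] theorem polyToRatFunc_C (a : A) : polyToRatFunc A (C a) = RatFunc.C (a : F) := by
  simp [polyToRatFunc]

/-- The ring of Laurent polynomials over `A` in one variable, inside the rational functions. -/
noncomputable def laurentPolys : Subalgebra K (RatFunc F) where
  carrier := {g | ∃ (n : ℕ) (P : A[X]), g * RatFunc.X ^ n = polyToRatFunc A P}
  mul_mem' := by
    rintro g h ⟨n, P, hP⟩ ⟨m, Q, hQ⟩
    refine ⟨n + m, P * Q, ?_⟩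
    rw [map_mul, ← hP, ← hQ]
    ring
  add_mem' := by
    rintro g h ⟨n, P, hP⟩ ⟨m, Q, hQ⟩
    refine ⟨n + m, P * X ^ m + Q * X ^ n, ?_⟩
    rw [map_add, map_mul, map_mul, ← hP, ← hQ]
    simp
    ring
  algebraMap_mem' r := by
    refine ⟨0, C (algebraMap K A r), ?_⟩
    rw [polyToRatFunc_C, pow_zero, mul_one, IsScalarTower.algebraMap_apply K F (RatFunc F)]
    rfl

variable {A}

theorem mem_laurentPolys {g : RatFunc F} :
    g ∈ laurentPolys A ↔ ∃ (n : ℕ) (P : A[X]), g * RatFunc.X ^ n = polyToRatFunc A P := Iff.rfl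

theorem polyToRatFunc_mem (P : A[X]) : polyToRatFunc A P ∈ laurentPolys A :=
  ⟨0, P, by simp⟩

theorem C_mem_laurentPolys {a : F} (ha : a ∈ A) : RatFunc.C a ∈ laurentPolys A := by
  have := polyToRatFunc_mem (C (⟨a, ha⟩ : A))
  rwa [polyToRatFunc_C] at this

theorem X_mem_laurentPolys : (RatFunc.X : RatFunc F) ∈ laurentPolys A := by
  have := polyToRatFunc_mem (X : A[X])
  rwa [polyToRatFunc_X] at this

theorem inv_X_mem_laurentPolys : (RatFunc.X : RatFunc F)⁻¹ ∈ laurentPolys A :=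
  ⟨1, 1, by simp [RatFunc.X_ne_zero]⟩

/-- Powers of `X` take the value `1` at `1`, so the choice of denominator does not affect `evalOne`.
-/
theorem eval_one_eq {g : RatFunc F} {n m : ℕ} {P Q : A[X]}
    (hP : g * RatFunc.X ^ n = polyToRatFunc A P) (hQ : g * RatFunc.X ^ m = polyToRatFunc A Q) :
    P.eval 1 = Q.eval 1 := by
  have : P * X ^ m = Q * X ^ n := by
    apply polyToRatFunc_injective A
    rw [map_mul, map_mul, ← hP, ← hQ]
    simp
    ring
  simpa using congrArg (eval 1) this

/-- Evaluation of Laurent polynomials at `1`. -/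
noncomputable def evalOne : laurentPolys A →+* A where
  toFun g := (mem_laurentPolys.1 g.2).choose_spec.choose.eval 1
  map_one' := by
    rw [eval_one_eq (mem_laurentPolys.1 (1 : laurentPolys A).2).choose_spec.choose_spec
      (m := 0) (Q := 1) (by simp), eval_one]
  map_zero' := by
    rw [eval_one_eq (mem_laurentPolys.1 (0 : laurentPolys A).2).choose_spec.choose_spec
      (m := 0) (Q := 0) (by simp), eval_zero]
  map_mul' g h := by
    have hg := (mem_laurentPolys.1 g.2).choose_spec.choose_spec
    have hh := (mem_laurentPolys.1 h.2).choose_spec.choose_spec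
    set n := (mem_laurentPolys.1 g.2).choose
    set m := (mem_laurentPolys.1 h.2).choose
    rw [← eval_mul]
    refine eval_one_eq (mem_laurentPolys.1 (g * h).2).choose_spec.choose_spec (m := n + m) ?_
    rw [map_mul, ← hg, ← hh, pow_add]
    push_cast
    ring
  map_add' g h := by
    have hg := (mem_laurentPolys.1 g.2).choose_spec.choose_spec
    have hh := (mem_laurentPolys.1 h.2).choose_spec.choose_spec
    set n := (mem_laurentPolys.1 g.2).choose
    set m := (mem_laurentPolys.1 h.2).choose
    set P := (mem_laurentPolys.1 g.2).choose_spec.choose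
    set Q := (mem_laurentPolys.1 h.2).choose_spec.choose
    have : P.eval 1 + Q.eval 1 = (P * X ^ m + Q * X ^ n).eval 1 := by simp
    rw [this]
    refine eval_one_eq (mem_laurentPolys.1 (g + h).2).choose_spec.choose_spec (m := n + m) ?_
    rw [map_add, map_mul, map_mul, ← hg, ← hh]
    simp
    ring

theorem evalOne_eq {g : RatFunc F} (hg : g ∈ laurentPolys A) {n : ℕ} {P : A[X]}
    (hP : g * RatFunc.X ^ n = polyToRatFunc A P) : evalOne ⟨g, hg⟩ = P.eval 1 :=
  eval_one_eq (mem_laurentPolys.1 hg).choose_spec.choose_spec hP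

/-- A rational function with denominators a power of `X - y` and `h` is a Laurent polynomial,
provided that `h` does not vanish at the unit `y`. -/
theorem mem_laurentPolys_of_mul {y : A} (hy : y ≠ 0) {H : A[X]}
    (hH : H.eval y ≠ 0) {g : RatFunc F} (hgH : g * polyToRatFunc A H ∈ laurentPolys A)
    {a : ℕ} (ha : g * polyToRatFunc A (X - C y) ^ a ∈ laurentPolys A) : g ∈ laurentPolys A := by
  induction a generalizing g with
  | zero => simpa using ha
  | succ a ih =>
    rw [pow_succ', ← mul_assoc] at ha
    have hg := ih (by
      rw [mul_right_comm]
      exact mul_mem hgH (polyToRatFunc_mem _)) ha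
    obtain ⟨n, P, hP⟩ := hg
    obtain ⟨m, Q, hQ⟩ := hgH
    have h1 : P * H * X ^ m = (X - C y) * Q * X ^ n := by
      apply polyToRatFunc_injective A
      simp only [map_mul, ← hP, ← hQ, map_pow, polyToRatFunc_X]
      ring
    have h2 : P.eval y = 0 := by
      -- At `y` the right side of `h1` vanishes while `H` and `X ^ m` do not, so `P` has the root
      -- `y` and one factor `X - y` cancels.
      have := congrArg (eval y) h1
      simp only [eval_mul, eval_sub, eval_X, eval_C, sub_self, zero_mul, eval_pow, mul_eq_zero,
        hH, or_false] at this
      exact this.resolve_right (pow_ne_zero _ hy)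
    obtain ⟨P', rfl⟩ := dvd_iff_isRoot.2 h2
    refine ⟨n, P', ?_⟩
    have h3 : polyToRatFunc A (X - C y) ≠ 0 :=
      (map_ne_zero_iff _ (polyToRatFunc_injective A)).2 (X_sub_C_ne_zero y)
    apply mul_left_cancel₀ h3
    rw [← map_mul, ← hP]
    ring

end LaurentPolynomials

/-! ### The seed with an additional frozen variable -/

namespace SeedData

variable {ι κ F : Type*} [Field F]

/-- The seed with an additional frozen variable, an indeterminate whose row in the matrix is
the unit vector at `j`. -/
noncomputable def extend [DecidableEq ι] (S : SeedData ι κ F) (j : ι) :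
    SeedData ι (Option κ) (RatFunc F) where
  var := Sum.elim (fun i => RatFunc.C (S.var (Sum.inl i)))
    (fun o => o.elim RatFunc.X fun k => RatFunc.C (S.var (Sum.inr k)))
  B l i := Sum.elim (fun a => S.B (Sum.inl a) i)
    (fun o => o.elim (if i = j then 1 else 0) fun k => S.B (Sum.inr k) i) l

variable [DecidableEq ι]

theorem extend_yHat [Fintype ι] [Fintype κ] (S : SeedData ι κ F) (j i : ι) : (S.extend j).yHat i =
    RatFunc.C (S.yHat i) * if i = j then RatFunc.X else 1 := by
  simp only [yHat, laurentMonomial, Fintype.prod_sum_type, Fintype.prod_option, extend]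
  simp only [Sum.elim_inl, Sum.elim_inr, Option.elim_none, Option.elim_some, map_mul, map_prod,
    map_zpow₀]
  split_ifs <;> simp
  ring

variable {K : Type*} [CommRing K] [Algebra K F]

theorem IsIndepSeed.extend {S : SeedData ι κ F}
    (hS : S.IsIndepSeed K) (j : ι) : (S.extend j).IsIndepSeed K := by
  refine ⟨?_, ?_⟩
  · have h1 : AlgebraicIndependent K fun l => RatFunc.C (S.var l) :=
      hS.indep.map' (f := IsScalarTower.toAlgHom K F (RatFunc F)) (RingHom.injective _)
    have h2 : AlgebraicIndependent F fun _ : Unit => (RatFunc.X : RatFunc F) :=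
      algebraicIndependent_unique_type_iff.2 RatFunc.transcendental_X
    have h3 := h1.sumElim_of_tower (S := F) (by
      rintro _ ⟨l, rfl⟩
      exact ⟨S.var l, rfl⟩) h2
    let e : ι ⊕ Option κ → Unit ⊕ (ι ⊕ κ) := Sum.elim (fun i => Sum.inr (Sum.inl i))
      fun o => o.elim (Sum.inl ()) fun k => Sum.inr (Sum.inr k)
    have he : Function.Injective e := by
      rintro (a | _ | a) (b | _ | b) <;> simp [e]
    have h4 : (S.extend j).var = Sum.elim (fun _ : Unit => (RatFunc.X : RatFunc F))
        (fun l => RatFunc.C (S.var l)) ∘ e := by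
      ext (a | _ | a) <;> rfl
    rw [h4]
    exact h3.comp e he
  · obtain ⟨d, hd, h⟩ := hS.exch
    exact ⟨d, hd, h⟩

end SeedData

end ClusterAlg

namespace ClusterAlg

open Finset Polynomial

namespace SeedData

variable {ι κ F : Type*} [Field F]

/-! ### Specialization of the additional variable to `1` -/

section Specialization

variable {K : Type*} [CommRing K] [Algebra K F]

/-- The variables and the matrix of `T` specialize to those of `S` when the additional frozen
variable is set to `1`. -/
structure SpecializesTo (A : Subalgebra K F) (T : SeedData ι (Option κ) (RatFunc F))
    (S : SeedData ι κ F) : Prop where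
  matrix : ∀ l i, T.B (Sum.map id some l) i = S.B l i
  mem : ∀ l, T.var l ∈ laurentPolys A
  evalOne_var : ∀ l, (evalOne ⟨_, mem (Sum.map id some l)⟩ : F) = S.var l
  evalOne_frozen : evalOne ⟨_, mem (Sum.inr none)⟩ = 1

theorem extend_laurentRing_le [DecidableEq ι] (S : SeedData ι κ F) (j : ι) :
    (S.extend j).laurentRing K ≤ laurentPolys (S.laurentRing K) := by
  rw [laurentRing, Algebra.adjoin_le_iff]
  rintro _ (⟨l, rfl⟩ | ⟨l, rfl⟩)
  · rcases l with l | _ | l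
    · exact C_mem_laurentPolys (S.var_mem_laurentRing _)
    · exact X_mem_laurentPolys
    · exact C_mem_laurentPolys (S.var_mem_laurentRing _)
  · rcases l with l | _ | l
    · simpa [extend] using C_mem_laurentPolys (S.inv_var_mem_laurentRing (K := K) (Sum.inl l))
    · exact inv_X_mem_laurentPolys
    · simpa [extend] using C_mem_laurentPolys (S.inv_var_mem_laurentRing (K := K) (Sum.inr l))

theorem extend_specializesTo [DecidableEq ι] (S : SeedData ι κ F) (j : ι) :
    SpecializesTo (S.laurentRing K) (S.extend j) S := by
  refine ⟨?_, fun l => extend_laurentRing_le S j (var_mem_laurentRing _ l), ?_, ?_⟩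
  · rintro (l | l) i <;> rfl
  · rintro (l | l)
    · rw [evalOne_eq _ (n := 0) (P := C ⟨_, S.var_mem_laurentRing _⟩) (by simp [extend]; rfl)]
      simp
    · rw [evalOne_eq _ (n := 0) (P := C ⟨_, S.var_mem_laurentRing _⟩) (by simp [extend]; rfl)]
      simp
  · rw [evalOne_eq _ (n := 0) (P := X) (by simp [extend])]
    simp

variable [Fintype ι] [Fintype κ]

theorem SpecializesTo.evalOne_prod {A : Subalgebra K F} {T : SeedData ι (Option κ) (RatFunc F)}
    {S : SeedData ι κ F} (h : SpecializesTo A T S) (e : ι ⊕ Option κ → ℕ) :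
    ((evalOne (∏ l, (⟨_, h.mem l⟩ : laurentPolys A) ^ e l) : A) : F) =
      ∏ l, S.var l ^ e (Sum.map id some l) := by
  simp only [Fintype.prod_sum_type, Fintype.prod_option, map_mul, map_prod, map_pow,
    h.evalOne_frozen]
  have h1 := fun i => h.evalOne_var (Sum.inl i)
  have h2 := fun k => h.evalOne_var (Sum.inr k)
  simp only [Sum.map_inl, Sum.map_inr, id_eq] at h1 h2
  simp [h1, h2]

variable [DecidableEq ι] [DecidableEq κ]

/-- The ring homomorphism `evalOne` is applied to the exchange relation in the form `x_i' * x_i =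
f_i`, which is free of division. -/
theorem SpecializesTo.mutate {A : Subalgebra K F} {T : SeedData ι (Option κ) (RatFunc F)}
    {S : SeedData ι κ F} (h : SpecializesTo A T S) (hT : ∀ l, T.var l ≠ 0)
    (hS : ∀ l, S.var l ≠ 0) (i : ι) (hmem : (T.mutate i).var (Sum.inl i) ∈ laurentPolys A) :
    SpecializesTo A (T.mutate i) (S.mutate i) := by
  have hmem' : ∀ l, (T.mutate i).var l ∈ laurentPolys A := fun l => by
    by_cases hl : l = Sum.inl i
    · rwa [hl]
    · rw [mutate_var_of_ne _ hl]
      exact h.mem l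
  have hinl : ∀ l : ι ⊕ κ, Sum.map id some l = Sum.inl i ↔ l = Sum.inl i := by
    rintro (a | a) <;> simp
  refine ⟨fun l k => ?_, hmem', fun l => ?_, ?_⟩
  · have h1 := h.matrix (Sum.inl i)
    simp only [Sum.map_inl, id_eq] at h1
    simp only [SeedData.mutate, mutateMatrix, hinl, h.matrix, h1]
  · by_cases hl : l = Sum.inl i
    · subst hl
      have h1 : (⟨_, hmem⟩ : laurentPolys A) * ⟨_, h.mem (Sum.inl i)⟩ =
          ∏ l, (⟨_, h.mem l⟩ : laurentPolys A) ^ (T.B l i).toNat +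
          ∏ l, (⟨_, h.mem l⟩ : laurentPolys A) ^ (-T.B l i).toNat := by
        apply Subtype.ext
        push_cast
        rw [mutate_var_self, div_mul_cancel₀ _ (hT _), exchangePoly]
      have h2 := congrArg (fun g => ((evalOne g : A) : F)) h1
      have h3 := h.evalOne_var (Sum.inl i)
      simp only [Sum.map_inl, id_eq] at h3
      simp only [map_mul, map_add, MulMemClass.coe_mul, AddMemClass.coe_add, h3,
        h.evalOne_prod (fun l => (T.B l i).toNat), h.evalOne_prod (fun l => (-T.B l i).toNat),
        h.matrix] at h2
      rw [mutate_var_self, eq_div_iff (hS _)]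
      exact h2
    · have hl' := (hinl l).not.2 hl
      rw [mutate_var_of_ne _ hl, ← h.evalOne_var l]
      simp only [mutate_var_of_ne _ hl']
  · rw [← h.evalOne_frozen]
    simp only [mutate_var_of_ne T (show Sum.inr none ≠ Sum.inl i by simp)]

end Specialization

/-! ### The Laurent phenomenon -/

variable [Fintype ι] [Fintype κ] [DecidableEq ι] [DecidableEq κ]

variable {K : Type*} [CommRing K] [CharZero K] [Algebra K F]

/-- A rational function in the Laurent rings of the mutations of an extended seed along `j` and
`j, k, j` is a Laurent polynomial in the variables of the extended seed. -/
theorem IsIndepSeed.mem_laurentPolys {S : SeedData ι κ F} (hS : S.IsIndepSeed K) {j k : ι}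
    (hjk : k ≠ j) {b : ℕ} (hb : S.B (Sum.inl j) k = b) {g : RatFunc F}
    (h1 : g ∈ ((S.extend j).mutate j).laurentRing K)
    (h3 : g ∈ ((((S.extend j).mutate j).mutate k).mutate j).laurentRing K) :
    g ∈ laurentPolys (S.laurentRing K) := by
  set A := S.laurentRing K
  set T := S.extend j
  have hT : T.IsIndepSeed K := hS.extend j
  have hle : T.laurentRing K ≤ laurentPolys A := extend_laurentRing_le S j
  obtain ⟨c, hc⟩ : ∃ c : ℕ, S.B (Sum.inl k) j = -c := by
    have : S.B (Sum.inl k) j ≤ 0 := hS.exch.nonpos (by rw [hb]; exact Int.natCast_nonneg b)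
    exact ⟨(-S.B (Sum.inl k) j).toNat, by omega⟩
  have hbc : b = 0 → c = 0 := fun h => by
    have := hS.exch.eq_zero (i := j) (j := k) (by rw [hb, h]; rfl)
    omega
  have hbc' : c = 0 ∨ b ≠ 0 := by tauto
  have hmonA : ∀ {m}, IsLaurentMonomial S.var m → m ∈ A := fun h => h.mem_laurentRing
  have hmonT : ∀ {m}, IsLaurentMonomial T.var m → m ∈ laurentPolys A := fun h =>
    hle h.mem_laurentRing
  have hp0 := hS.yHat_ne_zero j
  have hq0 := hS.yHat_ne_zero k
  set p : A := ⟨S.yHat j, hmonA ⟨_, rfl⟩⟩ with hp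
  set p' : A := ⟨(S.yHat j)⁻¹, hmonA (IsLaurentMonomial.inv ⟨_, rfl⟩)⟩ with hp'
  set q : A := ⟨S.yHat k, hmonA ⟨_, rfl⟩⟩ with hq
  have hpp' : p' * p = 1 := Subtype.ext (inv_mul_cancel₀ hp0)
  have hTp : T.yHat j = polyToRatFunc A (C p * X) := by
    rw [map_mul, polyToRatFunc_C, polyToRatFunc_X]
    exact (extend_yHat S j j).trans (by rw [if_pos rfl])
  have hTq : T.yHat k = polyToRatFunc A (C q) := by
    rw [polyToRatFunc_C]
    exact (extend_yHat S j k).trans (by rw [if_neg hjk, mul_one])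
  set D : A[X] := (1 + C p * X) ^ b + C q * (C p * X) ^ b with hD
  set E : A[X] := tripleNumerator b c (C p * X) (C q) with hE
  obtain ⟨m, hm, hz⟩ := hT.mutate_var_self j
  obtain ⟨n, hn, hu⟩ := hT.mutate_mutate_var hjk (b := b) hb
  obtain ⟨r, hr, hv⟩ := hT.mutate_mutate_mutate_var hjk (b := b) (c := c) hb hc
  have hTD : (1 + T.yHat j) ^ b + T.yHat k * T.yHat j ^ b = polyToRatFunc A D := by
    simp only [hTp, hTq, hD, map_add, map_pow, map_mul, map_one]
  have hTE : (1 + T.yHat j) * polyToRatFunc A E = T.yHat j * (polyToRatFunc A D) ^ c +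
      (T.yHat k * T.yHat j ^ b) ^ c := by
    have := congrArg (polyToRatFunc A) (one_add_mul_tripleNumerator hbc (C p * X) (C q))
    simpa only [hTp, hTq, hD, hE, map_add, map_pow, map_mul, map_one] using this
  rw [hTD] at hu hv
  rw [← hTE, mul_left_comm r] at hv
  have hv := mul_left_cancel₀ (hT.one_add_yHat_ne_zero j) hv
  have hm0 := hm.ne_zero hT.var_ne_zero
  have hn0 := hn.ne_zero hT.var_ne_zero
  have hr0 := hr.ne_zero hT.var_ne_zero
  have hT1 := hT.mutate j
  have hT2 := hT1.mutate k
  have hT3 := hT2.mutate j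
  have hkj : (Sum.inl k : ι ⊕ Option κ) ≠ Sum.inl j := fun h => hjk (Sum.inl_injective h)
  have h1p : 1 + T.yHat j = polyToRatFunc A (1 + C p * X) := by
    rw [map_add, map_one, hTp]
  -- The seed `μ_j` allows only powers of `1 + ŷ_j` as denominators.
  obtain ⟨a, ha⟩ : ∃ a : ℕ, g * (1 + T.yHat j) ^ a ∈ laurentPolys A := by
    have hw : 1 + T.yHat j ∈ laurentPolys A := by
      rw [h1p]
      exact polyToRatFunc_mem _
    refine exists_mul_pow_mem hw (fun l => ?_) (fun l => ?_) h1
    · by_cases hl : l = Sum.inl j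
      · rw [hl, hz]
        exact mul_mem (hmonT hm) hw
      · rw [mutate_var_of_ne _ hl]
        exact hle (var_mem_laurentRing _ _)
    · by_cases hl : l = Sum.inl j
      · rw [hl, hz, mul_inv, inv_mul_cancel_right₀ (hT.one_add_yHat_ne_zero j)]
        exact hmonT hm.inv
      · rw [mutate_var_of_ne _ hl]
        exact mul_mem (hle (inv_var_mem_laurentRing _ _)) hw
  -- After three mutations the new variables are, up to monomials, `D` and `E`.
  obtain ⟨a', ha'⟩ : ∃ a : ℕ, g * polyToRatFunc A (D * E) ^ a ∈ laurentPolys A := by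
    have hw := polyToRatFunc_mem (D * E)
    have hu' : ((((T.mutate j).mutate k).mutate j).var (Sum.inl k)) = n * polyToRatFunc A D := by
      rw [mutate_var_of_ne _ hkj, hu]
    have hD0 : polyToRatFunc A D ≠ 0 := fun h =>
      hT3.var_ne_zero (Sum.inl k) (by rw [hu', h, mul_zero])
    have hE0 : polyToRatFunc A E ≠ 0 := fun h =>
      hT3.var_ne_zero (Sum.inl j) (by rw [hv, h, mul_zero])
    have hother : ∀ l, l ≠ Sum.inl j → l ≠ Sum.inl k →
        (((T.mutate j).mutate k).mutate j).var l = T.var l := fun l hl hl' => by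
      rw [mutate_var_of_ne _ hl, mutate_var_of_ne _ hl', mutate_var_of_ne _ hl]
    refine exists_mul_pow_mem hw (fun l => ?_) (fun l => ?_) h3
    · by_cases hl : l = Sum.inl j
      · rw [hl, hv]
        exact mul_mem (hmonT hr) (polyToRatFunc_mem _)
      by_cases hl' : l = Sum.inl k
      · rw [hl', hu']
        exact mul_mem (hmonT hn) (polyToRatFunc_mem _)
      rw [hother l hl hl']
      exact hle (var_mem_laurentRing _ _)
    · by_cases hl : l = Sum.inl j
      · have : (r * polyToRatFunc A E)⁻¹ * polyToRatFunc A (D * E) =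
            r⁻¹ * polyToRatFunc A D := by
          rw [map_mul]
          field_simp
        rw [hl, hv, this]
        exact mul_mem (hmonT hr.inv) (polyToRatFunc_mem _)
      by_cases hl' : l = Sum.inl k
      · have : (n * polyToRatFunc A D)⁻¹ * polyToRatFunc A (D * E) =
            n⁻¹ * polyToRatFunc A E := by
          rw [map_mul]
          field_simp
        rw [hl', hu', this]
        exact mul_mem (hmonT hn.inv) (polyToRatFunc_mem _)
      rw [hother l hl hl']
      exact mul_mem (hle (inv_var_mem_laurentRing _ _)) hw
  -- Since `p` is a unit of `A` with inverse `p'`, the polynomial `1 + pX` has the root `-p'`; there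
  -- `pX` takes the value `-1`.
  have hX : (X - C (-p')) = C p' * (1 + C p * X) := by
    rw [mul_add, ← mul_assoc, ← C_mul, hpp', C_neg, C_1]
    ring
  have hpy : p * -p' = -1 := by rw [mul_neg, mul_comm, hpp']
  rw [← map_pow] at ha'
  refine mem_laurentPolys_of_mul (y := -p') (H := (D * E) ^ a') (a := a) ?_ ?_ ha' ?_
  · intro h
    rw [h, mul_zero] at hpy
    exact one_ne_zero (neg_eq_zero.1 hpy.symm)
  · have hcoe : ∀ x : A, (x : F) ≠ 0 → x ≠ 0 := fun x hx h => hx (by rw [h]; rfl)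
    rw [eval_pow, eval_mul]
    refine pow_ne_zero _ (mul_ne_zero (hcoe _ ?_) (hcoe _ ?_))
    · simp only [hD, eval_add, eval_pow, eval_one, eval_mul, eval_C, eval_X, hpy]
      rcases eq_or_ne b 0 with rfl | hb0
      · simpa [hq] using hS.one_add_yHat_ne_zero k
      · simpa [hq, hb0] using hq0
    · have h5 := map_tripleNumerator (A.val.toRingHom.comp (evalRingHom (-p'))) b c
        (C p * X) (C q)
      have h6 : (A.val.toRingHom.comp (evalRingHom (-p'))) (C p * X) = -1 := by
        simp only [RingHom.comp_apply, coe_evalRingHom, eval_mul, eval_C, eval_X, hpy]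
        simp
      have h7 : (A.val.toRingHom.comp (evalRingHom (-p'))) (C q) = S.yHat k := by
        simp [hq]
      rw [h6, h7] at h5
      have h8 : tripleNumerator b c (-1) (S.yHat k) ≠ 0 := by
        refine tripleNumerator_neg_one_ne_zero hq0 ?_
        -- For `b ≠ 0` the monomial `q = ŷ_k` is nontrivial, hence not the constant `-c`; for `c =
        -- 0` it suffices that `q ≠ 0`.
        rcases hbc' with rfl | hb0
        · simpa using hq0
        · have := hS.yHat_ne_algebraMap (l := Sum.inl j) (i := k) (by rw [hb]; exact_mod_cast hb0)
            (-(c : K))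
          simpa using this
      rw [← h5] at h8
      exact h8
  · rw [hX, map_mul, mul_pow, ← h1p, mul_left_comm]
    exact mul_mem (pow_mem (polyToRatFunc_mem _) _) ha

/-- Mutation along a list of directions. -/
noncomputable def mutations (S : SeedData ι κ F) (w : List ι) : SeedData ι κ F :=
  w.foldl SeedData.mutate S

theorem mutations_append_singleton (S : SeedData ι κ F) (w : List ι) (i : ι) :
    S.mutations (w ++ [i]) = (S.mutations w).mutate i := by
  simp [mutations]

theorem IsIndepSeed.mutations {S : SeedData ι κ F} (hS : S.IsIndepSeed K) (w : List ι) :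
    (S.mutations w).IsIndepSeed K := by
  induction w generalizing S with
  | nil => exact hS
  | cons i w ih => exact ih (hS.mutate i)

/-- Negating `B` swaps the two terms of the exchange polynomial; this allows the reduction to `b_jk
≥ 0`. -/
theorem mutate_neg (S : SeedData ι κ F) (i : ι) :
    (SeedData.mk S.var (-S.B)).mutate i = ⟨(S.mutate i).var, -(S.mutate i).B⟩ := by
  simp [mutate, exchangePoly, mutateMatrix_neg, add_comm]

theorem mutations_neg (S : SeedData ι κ F) (w : List ι) :
    (SeedData.mk S.var (-S.B)).mutations w = ⟨(S.mutations w).var, -(S.mutations w).B⟩ := by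
  induction w generalizing S with
  | nil => rfl
  | cons i w ih =>
    show ((SeedData.mk S.var (-S.B)).mutate i).mutations w = _
    rw [mutate_neg, ih]
    rfl

/-- Since `evalOne` is defined only on Laurent polynomials, every intermediate seed must consist of
them; hence the condition on prefixes. -/
theorem SpecializesTo.mutations {A : Subalgebra K F} {T : SeedData ι (Option κ) (RatFunc F)}
    {S : SeedData ι κ F} (h : SpecializesTo A T S) (hT : T.IsIndepSeed K) (hS : S.IsIndepSeed K)
    (w : List ι) (hw : ∀ v, v <+: w → ∀ l, (T.mutations v).var l ∈ laurentPolys A) :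
    SpecializesTo A (T.mutations w) (S.mutations w) := by
  induction w using List.reverseRecOn with
  | nil => exact h
  | append_singleton w i ih =>
    have := ih fun v hv => hw v (hv.trans (List.prefix_append w [i]))
    have h' := hw _ List.prefix_rfl (Sum.inl i)
    rw [mutations_append_singleton] at h' ⊢
    rw [mutations_append_singleton]
    exact this.mutate (hT.mutations w).var_ne_zero (hS.mutations w).var_ne_zero i h'

end SeedData

open SeedData

/-- The Laurent phenomenon, by induction on the number of mutations. -/
theorem laurent_of_length_le.{u, v} {ι K : Type*} [Fintype ι] [DecidableEq ι] [CommRing K]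
    [CharZero K] (d : ℕ) : ∀ {κ : Type v} {F : Type u} [Fintype κ] [DecidableEq κ] [Field F]
    [Algebra K F] {S : SeedData ι κ F}, S.IsIndepSeed K → ∀ w : List ι, w.length ≤ d →
    ∀ l, (S.mutations w).var l ∈ S.laurentRing K := by
  -- The induction hypothesis covers all `κ` and `F`, because it is applied to the extended seed,
  -- over `Option κ` and `RatFunc F`.
  induction d with
  | zero =>
    intro κ F _ _ _ _ S hS w hw l
    rw [List.length_eq_zero_iff.1 (Nat.le_zero.1 hw)]
    exact S.var_mem_laurentRing l
  | succ d ih =>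
    intro κ F _ _ _ _ S hS w hw l
    rcases w with _ | ⟨j, _ | ⟨k, w⟩⟩
    · exact S.var_mem_laurentRing l
    · show (S.mutate j).var l ∈ _
      by_cases hl : l = Sum.inl j
      · obtain ⟨m, hm, hz⟩ := hS.mutate_var_self j
        rw [hl, hz]
        exact mul_mem hm.mem_laurentRing
          (add_mem (one_mem _) (S.laurentMonomial_mem_laurentRing _))
      · rw [mutate_var_of_ne _ hl]
        exact S.var_mem_laurentRing l
    simp only [List.length_cons] at hw
    by_cases hjk : k = j
    · subst hjk
      show (((S.mutate k).mutate k).mutations w).var l ∈ _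
      rw [hS.mutate_mutate]
      exact ih hS w (by omega) l
    have key : ∀ {S : SeedData ι κ F}, S.IsIndepSeed K → 0 ≤ S.B (Sum.inl j) k →
        (S.mutations (j :: k :: w)).var l ∈ S.laurentRing K := by
      intro S hS hb
      obtain ⟨b, hb⟩ := Int.eq_ofNat_of_zero_le hb
      have hT := hS.extend j
      have hT1 := hT.mutate j
      have hT2 := hT1.mutate k
      have h := (extend_specializesTo S j).mutations hT hS (j :: k :: w) (fun v hv l => by
        by_cases hvw : v.length ≤ d
        · exact extend_laurentRing_le S j (ih hT v hvw l)
        have hlen := hv.length_le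
        have : v = j :: k :: w := hv.eq_of_length (by simp only [List.length_cons] at *; omega)
        subst this
        refine hS.mem_laurentPolys hjk hb (ih hT1 (k :: w) (by simp; omega) l) ?_
        -- From `μ_j μ_k μ_j` the word `j :: w` leads to the same seed, as the two consecutive
        -- mutations at `j` cancel; its length is at most `d`.
        have h3 := ih (hT2.mutate j) (j :: w) (by simp; omega) l
        change (((((((S.extend j).mutate j).mutate k).mutate j).mutate j).mutations w).var l) ∈ _
          at h3
        rw [hT2.mutate_mutate] at h3
        exact h3)
      rw [← h.evalOne_var l]
      exact SetLike.coe_mem _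
    rcases le_total 0 (S.B (Sum.inl j) k) with hb | hb
    · exact key hS hb
    · have := key (S := ⟨S.var, -S.B⟩) ⟨hS.indep, hS.exch.neg⟩ (by simpa using hb)
      rw [mutations_neg] at this
      exact this

end ClusterAlg

namespace ClusterAlg

/-! ### Divisors of monomials and strong atoms -/

open Finset

/-- A nonzero nonunit is a strong atom if all divisors of its powers are associated to powers. -/
theorem isStrongAtom_of_dvd_pow {R : Type*} [CommRing R] [IsDomain R] {u : R} (h0 : u ≠ 0)
    (hu : ¬ IsUnit u) (h : ∀ (n : ℕ) (a : R), a ∣ u ^ n → ∃ e : ℕ, Associated a (u ^ e)) :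
    IsStrongAtom u := by
  refine ⟨⟨hu, fun a b hab => ?_⟩, fun n _ s hs hprod => ?_⟩
  · obtain ⟨e, he⟩ := h 1 a ⟨b, by rw [pow_one, hab]⟩
    obtain _ | e := e
    · left
      exact associated_one_iff_isUnit.1 (by simpa using he)
    · right
      have h1 : u ∣ a := (dvd_pow_self u e.succ_ne_zero).trans he.symm.dvd
      obtain ⟨t, rfl⟩ := h1
      have : t * b = 1 := mul_left_cancel₀ h0 (by rw [mul_one, ← mul_assoc, ← hab])
      exact IsUnit.of_mul_eq_one t (by rw [mul_comm, this])
  · have hass : ∀ a ∈ s, Associated a u := fun a ha => by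
      obtain ⟨e, he⟩ := h n a (hprod ▸ Multiset.dvd_prod ha)
      have hirr := he.irreducible (hs a ha)
      have he1 : e = 1 := by
        by_contra hne
        exact not_irreducible_pow hne hirr
      simpa [he1] using he
    have hrel : ∀ t : Multiset R, (∀ a ∈ t, Associated a u) → Associated t.prod (u ^ t.card) := by
      intro t
      induction t using Multiset.induction with
      | empty => simp
      | cons a t ih =>
        intro ht
        rw [Multiset.prod_cons, Multiset.card_cons, pow_succ']
        exact (ht a (Multiset.mem_cons_self a t)).mul_mul
          (ih fun b hb => ht b (Multiset.mem_cons_of_mem hb))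
    have hpow : Associated (u ^ n) (u ^ s.card) := hprod ▸ hrel s hass
    have hcard : s.card = n := by
      apply le_antisymm
      · exact (pow_dvd_pow_iff h0 hu).1 hpow.symm.dvd
      · exact (pow_dvd_pow_iff h0 hu).1 hpow.dvd
    exact Multiset.rel_replicate_right.2 ⟨hcard, hass⟩

section LaurentMonomial

variable {σ F K : Type*} [Fintype σ] [Field F] [CommRing K] [Algebra K F]

theorem aeval_monomial_eq_laurentMonomial (x : σ → F) (m : σ →₀ ℕ) (c : K) :
    MvPolynomial.aeval x (MvPolynomial.monomial m c) =
      c • laurentMonomial x fun l => (m l : ℤ) := by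
  rw [MvPolynomial.aeval_monomial, Algebra.smul_def, Finsupp.prod_fintype _ _ fun _ => pow_zero _]
  simp [laurentMonomial]

theorem smul_laurentMonomial_injective {x : σ → F} (hx : AlgebraicIndependent K x)
    (hx0 : ∀ l, x l ≠ 0) {c c' : K} (hc : c ≠ 0) {e e' : σ → ℤ}
    (h : c • laurentMonomial x e = c' • laurentMonomial x e') : e = e' ∧ c = c' := by
  have h1 : Finsupp.linearCombination K (laurentMonomial x) (Finsupp.single e c) =
      Finsupp.linearCombination K (laurentMonomial x) (Finsupp.single e' c') := by
    simpa using h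
  have h2 := (linearIndependent_laurentMonomial hx hx0) h1
  rcases (Finsupp.single_eq_single_iff _ _ _ _).1 h2 with h3 | h3
  · exact h3
  · exact absurd h3.1 hc

end LaurentMonomial

namespace SeedData

variable {ι κ F : Type*} [Field F] {K : Type*} [CommRing K] [Algebra K F]

theorem exists_mul_laurentMonomial_eq_aeval (S : SeedData ι κ F) (h0 : ∀ l, S.var l ≠ 0) {g : F}
    (hg : g ∈ S.laurentRing K) : ∃ (m : ι ⊕ κ →₀ ℕ) (P : MvPolynomial (ι ⊕ κ) K),
      g * MvPolynomial.aeval S.var (MvPolynomial.monomial m (1 : K)) =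
        MvPolynomial.aeval S.var P := by
  have hadd : ∀ m n : ι ⊕ κ →₀ ℕ, MvPolynomial.monomial (m + n) (1 : K) =
      MvPolynomial.monomial m 1 * MvPolynomial.monomial n 1 := fun m n => by
    rw [MvPolynomial.monomial_mul, mul_one]
  induction hg using Algebra.adjoin_induction with
  | mem g hg =>
    rcases hg with ⟨l, rfl⟩ | ⟨l, rfl⟩
    · exact ⟨0, MvPolynomial.X l, by simp⟩
    · refine ⟨Finsupp.single l 1, 1, ?_⟩
      rw [← MvPolynomial.X, MvPolynomial.aeval_X, map_one]
      exact inv_mul_cancel₀ (h0 l)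
  | algebraMap r => exact ⟨0, MvPolynomial.C r, by simp⟩
  | add g h _ _ hg hh =>
    obtain ⟨m, P, hP⟩ := hg
    obtain ⟨n, Q, hQ⟩ := hh
    refine ⟨m + n, P * MvPolynomial.monomial n 1 + Q * MvPolynomial.monomial m 1, ?_⟩
    rw [hadd, map_add, map_mul, map_mul, map_mul, ← hP, ← hQ]
    ring
  | mul g h _ _ hg hh =>
    obtain ⟨m, P, hP⟩ := hg
    obtain ⟨n, Q, hQ⟩ := hh
    refine ⟨m + n, P * Q, ?_⟩
    rw [hadd, map_mul, map_mul, ← hP, ← hQ]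
    ring

variable [Fintype ι] [Fintype κ]

/-- In the Laurent ring, the divisors of Laurent monomials are, up to unit constants, Laurent
monomials. -/
theorem exists_eq_smul_laurentMonomial [IsDomain K] {S : SeedData ι κ F}
    (hS : AlgebraicIndependent K S.var) {g h : F} (hg : g ∈ S.laurentRing K)
    (hh : h ∈ S.laurentRing K) {e : ι ⊕ κ → ℤ} (hgh : g * h = laurentMonomial S.var e) :
    ∃ (c : K) (a : ι ⊕ κ → ℤ), IsUnit c ∧ g = c • laurentMonomial S.var a := by
  have h0 : ∀ l, S.var l ≠ 0 := hS.ne_zero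
  obtain ⟨m, P, hP⟩ := S.exists_mul_laurentMonomial_eq_aeval h0 hg
  obtain ⟨n, Q, hQ⟩ := S.exists_mul_laurentMonomial_eq_aeval h0 hh
  set ep : ι ⊕ κ →₀ ℕ := Finsupp.equivFunOnFinite.symm fun l => (e l).toNat with hep
  set en : ι ⊕ κ →₀ ℕ := Finsupp.equivFunOnFinite.symm fun l => (-e l).toNat with hen
  -- With `e = ep - en` all denominators are cleared, and over a domain the divisors of a monic
  -- monomial are monomials with unit coefficient.
  have hPQ : P * (Q * MvPolynomial.monomial en 1) = MvPolynomial.monomial (m + n + ep) 1 := by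
    apply algebraicIndependent_iff_injective_aeval.1 hS
    rw [map_mul, map_mul, ← hP, ← hQ]
    rw [show g * MvPolynomial.aeval S.var (MvPolynomial.monomial m (1 : K)) *
      (h * MvPolynomial.aeval S.var (MvPolynomial.monomial n (1 : K)) *
        MvPolynomial.aeval S.var (MvPolynomial.monomial en (1 : K))) = (g * h) *
      (MvPolynomial.aeval S.var (MvPolynomial.monomial m (1 : K)) *
      MvPolynomial.aeval S.var (MvPolynomial.monomial n (1 : K)) *
        MvPolynomial.aeval S.var (MvPolynomial.monomial en (1 : K))) by ring, hgh]
    simp only [aeval_monomial_eq_laurentMonomial, one_smul, ← laurentMonomial_add h0]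
    congr 1
    ext l
    simp [hep, hen]
    omega
  obtain ⟨a, c, -, hc, rfl⟩ := MvPolynomial.dvd_monomial_one_iff_exists.1 (Dvd.intro _ hPQ)
  refine ⟨c, (fun l => (a l : ℤ)) + -(fun l => (m l : ℤ)), hc, ?_⟩
  rw [aeval_monomial_eq_laurentMonomial, aeval_monomial_eq_laurentMonomial, one_smul] at hP
  rw [laurentMonomial_add h0, laurentMonomial_neg, ← smul_mul_assoc, ← hP,
    mul_inv_cancel_right₀ (laurentMonomial_ne_zero h0 _)]

variable [CharZero K]

/-- An invertible `1 + ŷ_i` would be a unit constant times a monomial. It has two distinct terms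
unless column `i` is zero, and then it is `2`; this explains `hcol`. -/
theorem IsIndepSeed.not_inv_one_add_yHat_mem [IsDomain K] {S : SeedData ι κ F}
    (hS : S.IsIndepSeed K) {i : ι} (hcol : (∀ l, S.B l i = 0) → ¬ IsUnit (2 : K)) :
    (1 + S.yHat i)⁻¹ ∉ S.laurentRing K := by
  intro hmem
  have hmem' : 1 + S.yHat i ∈ S.laurentRing K :=
    add_mem (one_mem _) (S.laurentMonomial_mem_laurentRing _)
  obtain ⟨c, a, hc, h⟩ := exists_eq_smul_laurentMonomial (e := 0) hS.indep hmem' hmem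
    (by rw [laurentMonomial_zero, mul_inv_cancel₀ (hS.one_add_yHat_ne_zero i)])
  by_cases h0 : (fun l => S.B l i) = 0
  · refine hcol (fun l => congrFun h0 l) ?_
    rw [yHat, h0, laurentMonomial_zero] at h
    have : (2 : K) • laurentMonomial S.var 0 = c • laurentMonomial S.var a := by
      rw [← h, laurentMonomial_zero, Algebra.smul_def, map_ofNat]
      norm_num
    rw [(smul_laurentMonomial_injective hS.indep hS.var_ne_zero two_ne_zero this).2]
    exact hc
  · exact one_add_laurentMonomial_ne hS.indep hS.var_ne_zero h0 c a h

variable [DecidableEq ι] [DecidableEq κ]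

theorem IsIndepSeed.nonneg_of_mem_laurentRing_mutate [IsDomain K] {S : SeedData ι κ F}
    (hS : S.IsIndepSeed K) {i : ι} (hcol : (∀ l, S.B l i = 0) → ¬ IsUnit (2 : K)) {c : K}
    (hc : IsUnit c) {e : ι ⊕ κ → ℤ}
    (h : c • laurentMonomial S.var e ∈ (S.mutate i).laurentRing K) : 0 ≤ e (Sum.inl i) := by
  have hT := hS.mutate i
  have hcolT : (∀ l, (S.mutate i).B l i = 0) → ¬ IsUnit (2 : K) := fun h => hcol fun l => by
    have := h l
    simpa [SeedData.mutate, mutateMatrix_col] using this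
  by_contra hneg
  -- In the mutated seed the element is a monomial times `(1 + ŷ_i) ^ (-(n + 1))`; multiplying by
  -- `(1 + ŷ_i) ^ n` leaves the forbidden inverse.
  obtain ⟨n, hn⟩ : ∃ n : ℕ, e (Sum.inl i) = -((n + 1 : ℕ) : ℤ) :=
    ⟨(-e (Sum.inl i) - 1).toNat, by omega⟩
  apply hT.not_inv_one_add_yHat_mem hcolT
  obtain ⟨m, hm, hz⟩ := hT.mutate_var_self i
  have hmon := laurentMonomial_mutate (S.mutate i) i e
  rw [hz, hS.mutate_mutate, hn, zpow_neg, zpow_natCast] at hmon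
  set a := laurentMonomial (S.mutate i).var (Function.update e (Sum.inl i) 0) with ha
  have ha' : IsLaurentMonomial (S.mutate i).var a := ⟨_, rfl⟩
  have ha0 := ha'.ne_zero hT.var_ne_zero
  have hm0 := hm.ne_zero hT.var_ne_zero
  obtain ⟨c, rfl⟩ := hc
  have hT0 := hT.one_add_yHat_ne_zero i
  have key : (1 + (S.mutate i).yHat i)⁻¹ = a⁻¹ * m ^ (n + 1) * (1 + (S.mutate i).yHat i) ^ n *
      (((c⁻¹ : Kˣ) : K) • ((c : K) • laurentMonomial S.var e)) := by
    rw [smul_smul, Units.inv_mul, one_smul, hmon]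
    field_simp
    rw [mul_pow]
    ring
  rw [key]
  refine mul_mem (mul_mem (mul_mem ha'.inv.mem_laurentRing (hm.pow _).mem_laurentRing)
    (pow_mem (add_mem (one_mem _) (laurentMonomial_mem_laurentRing _ _)) _))
    (Subalgebra.smul_mem _ h _)

theorem IsIndepSeed.isStrongAtom [IsDomain K] {S : SeedData ι κ F} (hS : S.IsIndepSeed K)
    (hcol : ∀ i, (∀ l, S.B l i = 0) → ¬ IsUnit (2 : K)) {H : Subalgebra K F}
    (hH : H ≤ S.laurentRing K) (hHmut : ∀ i, H ≤ (S.mutate i).laurentRing K)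
    (hvar : ∀ l, S.var l ∈ H) (hinv : ∀ k, (S.var (Sum.inr k))⁻¹ ∈ H) (i : ι) :
    IsStrongAtom (⟨S.var (Sum.inl i), hvar _⟩ : H) := by
  have h0 := hS.var_ne_zero
  have hmonH : ∀ a : ι ⊕ κ → ℤ, (∀ j, a (Sum.inl j) = 0) → laurentMonomial S.var a ∈ H := by
    intro a ha
    refine Subalgebra.prod_mem _ fun l _ => ?_
    rcases l with l | l
    · rw [ha, zpow_zero]
      exact one_mem _
    · obtain ⟨n, hn | hn⟩ := (a (Sum.inr l)).eq_nat_or_neg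
      · rw [hn, zpow_natCast]
        exact pow_mem (hvar _) n
      · rw [hn, zpow_neg, zpow_natCast, ← inv_pow]
        exact pow_mem (hinv _) n
  refine isStrongAtom_of_dvd_pow ?_ ?_ ?_
  · exact fun h => h0 _ (congrArg Subtype.val h)
  · intro hu
    obtain ⟨v, hv⟩ := hu.exists_right_inv
    have hv' : S.var (Sum.inl i) * v = 1 := congrArg Subtype.val hv
    have hv2 : (v : F) = (1 : K) • laurentMonomial S.var (Pi.single (Sum.inl i) (-1)) := by
      rw [one_smul, laurentMonomial_single, zpow_neg_one]
      exact eq_inv_of_mul_eq_one_right hv'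
    have := hS.nonneg_of_mem_laurentRing_mutate (hcol i) isUnit_one (hv2 ▸ hHmut i v.2)
    simp at this
  · rintro n a ⟨b, hab⟩
    have hab' : (a : F) * b = laurentMonomial S.var (Pi.single (Sum.inl i) (n : ℤ)) := by
      rw [laurentMonomial_single, zpow_natCast]
      exact (congrArg Subtype.val hab).symm
    obtain ⟨c, e, hc, ha⟩ := exists_eq_smul_laurentMonomial hS.indep (hH a.2) (hH b.2) hab'
    obtain ⟨c', e', hc', hb⟩ := exists_eq_smul_laurentMonomial hS.indep (hH b.2) (hH a.2)
      ((mul_comm _ _).trans hab')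
    have he : ∀ j, 0 ≤ e (Sum.inl j) := fun j =>
      hS.nonneg_of_mem_laurentRing_mutate (hcol j) hc (ha ▸ hHmut j a.2)
    have he' : ∀ j, 0 ≤ e' (Sum.inl j) := fun j =>
      hS.nonneg_of_mem_laurentRing_mutate (hcol j) hc' (hb ▸ hHmut j b.2)
    have hsum : e + e' = Pi.single (Sum.inl i) (n : ℤ) := by
      refine (smul_laurentMonomial_injective hS.indep h0 (c := c * c') (c' := 1)
        (mul_ne_zero hc.ne_zero hc'.ne_zero) ?_).1
      rw [one_smul, ← hab', ha, hb, laurentMonomial_add h0, smul_mul_smul_comm]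
    -- For `j ≠ i` two nonnegative exponents sum to `0`. So, apart from the power of `x_i`, only
    -- frozen variables remain, and these are units of `H`.
    have hej : ∀ j, Function.update e (Sum.inl i) 0 (Sum.inl j) = 0 := fun j => by
      by_cases hj : j = i
      · rw [hj, Function.update_self]
      · have hj' : (Sum.inl j : ι ⊕ κ) ≠ Sum.inl i := fun h => hj (Sum.inl_injective h)
        rw [Function.update_of_ne hj']
        have := congrFun hsum (Sum.inl j)
        rw [Pi.add_apply, Pi.single_eq_of_ne hj'] at this
        have := he j
        have := he' j
        omega
    obtain ⟨t, ht⟩ := Int.eq_ofNat_of_zero_le (he i)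
    obtain ⟨c, rfl⟩ := hc
    have hmon := laurentMonomial_update_zero h0 (Sum.inl i) e
    rw [ht, zpow_natCast] at hmon
    have hpow0 : S.var (Sum.inl i) ^ t ≠ 0 := pow_ne_zero _ (h0 _)
    set r := laurentMonomial S.var (Function.update e (Sum.inl i) 0) with hr
    have hr0 : r ≠ 0 := laurentMonomial_ne_zero h0 _
    have hrH : r ∈ H := hmonH _ hej
    have hrH' : r⁻¹ ∈ H := by
      rw [hr, ← laurentMonomial_neg]
      exact hmonH _ fun j => by rw [Pi.neg_apply, hej, neg_zero]
    have hae : (a : F) = (c : K) • (r * S.var (Sum.inl i) ^ t) := by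
      rw [ha, hmon, inv_mul_cancel_right₀ hpow0]
    refine ⟨t, associated_of_dvd_dvd ⟨⟨((c⁻¹ : Kˣ) : K) • r⁻¹, H.smul_mem hrH' _⟩, ?_⟩
      ⟨⟨(c : K) • r, H.smul_mem hrH _⟩, ?_⟩⟩
    · apply Subtype.ext
      show S.var (Sum.inl i) ^ t = (a : F) * (((c⁻¹ : Kˣ) : K) • r⁻¹)
      rw [hae, smul_mul_smul_comm, Units.mul_inv, one_smul]
      field_simp
    · apply Subtype.ext
      show (a : F) = S.var (Sum.inl i) ^ t * ((c : K) • r)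
      rw [hae, mul_smul_comm, mul_comm]

theorem MutationEquiv.exists_mutations {S T : SeedData ι κ F} (h : S.MutationEquiv T) :
    ∃ w, T = S.mutations w := by
  induction h with
  | refl => exact ⟨[], rfl⟩
  | tail _ h ih =>
    obtain ⟨w, rfl⟩ := ih
    obtain ⟨i, rfl⟩ := h
    exact ⟨w ++ [i], (mutations_append_singleton S w i).symm⟩

theorem IsIndepSeed.of_mutationEquiv {S T : SeedData ι κ F} (hS : S.IsIndepSeed K)
    (h : S.MutationEquiv T) : T.IsIndepSeed K := by
  obtain ⟨w, rfl⟩ := h.exists_mutations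
  exact hS.mutations w

theorem IsIndepSeed.mutationEquiv_symm {S T : SeedData ι κ F} (hS : S.IsIndepSeed K)
    (h : S.MutationEquiv T) : T.MutationEquiv S := by
  induction h with
  | refl => exact .refl
  | tail h h' ih =>
    obtain ⟨i, rfl⟩ := h'
    exact .head ⟨i, ((hS.of_mutationEquiv h).mutate_mutate i).symm⟩ ih

theorem MutationEquiv.var_inr {S T : SeedData ι κ F} (h : S.MutationEquiv T) (k : κ) :
    T.var (Sum.inr k) = S.var (Sum.inr k) := by
  induction h with
  | refl => rfl
  | tail _ h ih =>
    obtain ⟨i, rfl⟩ := h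
    rw [mutate_var_of_ne _ (by simp), ih]

/-- Under mutation at `j ≠ i`, a nonzero entry of column `i` in row `j` only changes sign; if that
entry is zero, column `i` is unchanged. -/
theorem MutationEquiv.exists_ne_zero {S T : SeedData ι κ F} (h : S.MutationEquiv T)
    (hS : ∀ i, ∃ l, S.B l i ≠ 0) (i : ι) : ∃ l, T.B l i ≠ 0 := by
  induction h generalizing i with
  | refl => exact hS i
  | @tail T _ _ h ih =>
    obtain ⟨j, rfl⟩ := h
    by_cases hij : i = j
    · subst hij
      obtain ⟨l, hl⟩ := ih i
      exact ⟨l, by simpa [SeedData.mutate, mutateMatrix_col] using hl⟩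
    by_cases hji : T.B (Sum.inl j) i = 0
    · obtain ⟨l, hl⟩ := ih i
      refine ⟨l, ?_⟩
      have hlj : l ≠ Sum.inl j := fun h => hl (h ▸ hji)
      simpa [SeedData.mutate, mutateMatrix_apply_of_ne _ hlj hij, hji] using hl
    · exact ⟨Sum.inl j, by simpa [SeedData.mutate, mutateMatrix_row] using hji⟩

/-- The Laurent phenomenon. -/
theorem IsIndepSeed.var_mem_laurentRing {S T T' : SeedData ι κ F} (hS : S.IsIndepSeed K)
    (h : S.MutationEquiv T) (h' : S.MutationEquiv T') (l : ι ⊕ κ) :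
    T.var l ∈ T'.laurentRing K := by
  have hT : T'.MutationEquiv T := (hS.mutationEquiv_symm h').trans h
  obtain ⟨w, rfl⟩ := hT.exists_mutations
  exact laurent_of_length_le _ (hS.of_mutationEquiv h') w le_rfl l

theorem IsIndepSeed.clusterAlgebra_le_upperClusterAlgebra {S : SeedData ι κ F}
    (hS : S.IsIndepSeed K) : S.clusterAlgebra K ≤ S.upperClusterAlgebra K := by
  rw [clusterAlgebra, Algebra.adjoin_le_iff]
  intro g hg
  rw [SetLike.mem_coe, upperClusterAlgebra, Algebra.mem_iInf]
  rintro ⟨T, hT⟩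
  rcases hg with (⟨T', hT', i, rfl⟩ | ⟨k, rfl⟩) | ⟨k, rfl⟩
  · exact hS.var_mem_laurentRing hT' hT _
  · show S.var (Sum.inr k) ∈ _
    rw [← hT.var_inr]
    exact SeedData.var_mem_laurentRing _ _
  · show (S.var (Sum.inr k))⁻¹ ∈ _
    rw [← hT.var_inr]
    exact inv_var_mem_laurentRing _ _

/-- Working with any `H` between the two algebras treats both at once. -/
theorem IsIndepSeed.isStrongAtom_of_le [IsDomain K] {S T : SeedData ι κ F} (hS : S.IsIndepSeed K)
    (hT : S.MutationEquiv T) (hcol : ∀ i, (∀ l, T.B l i = 0) → ¬ IsUnit (2 : K))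
    {H : Subalgebra K F} (hAH : S.clusterAlgebra K ≤ H) (hHU : H ≤ S.upperClusterAlgebra K)
    (i : ι) : ∃ h : T.var (Sum.inl i) ∈ H, IsStrongAtom (⟨T.var (Sum.inl i), h⟩ : H) := by
  have hle : ∀ {T'}, S.MutationEquiv T' → H ≤ T'.laurentRing K := fun {T'} hT' g hg =>
    Algebra.mem_iInf.1 (hHU hg) ⟨T', hT'⟩
  have hvar : ∀ l, T.var l ∈ H := by
    rintro (j | k)
    · exact hAH (Algebra.subset_adjoin (Or.inl (Or.inl ⟨T, hT, j, rfl⟩)))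
    · rw [hT.var_inr]
      exact hAH (Algebra.subset_adjoin (Or.inl (Or.inr ⟨k, rfl⟩)))
  have hinv : ∀ k, (T.var (Sum.inr k))⁻¹ ∈ H := fun k => by
    rw [hT.var_inr]
    exact hAH (Algebra.subset_adjoin (Or.inr ⟨k, rfl⟩))
  exact ⟨hvar _, (hS.of_mutationEquiv hT).isStrongAtom hcol (hle hT)
    (fun j => hle (hT.tail ⟨j, rfl⟩)) hvar hinv i⟩

end SeedData

theorem IsExchangeMatrix.exists_ne_zero_of_not_isIsolated {ι κ : Type*}
    {B : Matrix (ι ⊕ κ) ι ℤ} (hB : IsExchangeMatrix B) {i : ι} (h : ¬ IsIsolated B i) :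
    ∃ l, B l i ≠ 0 := by
  by_contra! h0
  refine h fun v => ⟨?_, ?_⟩
  · rcases v with j | k
    · simp [iceQuiverArrows, hB.eq_zero (h0 (Sum.inl j))]
    · simp [iceQuiverArrows, h0]
  · simp [iceQuiverArrows, h0]

end ClusterAlg

theorem corollary2p4 {K F : Type*} [CommRing K] [CharZero K] [Field F] [Algebra K F]
    (hK : IsField K ∨ Nonempty (K ≃+* ℤ))
    {n m : ℕ} (S : ClusterAlg.SeedData (Fin n) (Fin m) F) (hS : S.IsSeed K)
    (hiso : IsField K → ∀ i : Fin n, ¬ ClusterAlg.IsIsolated S.B i)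
    (x : F) (hx : x ∈ S.clusterVariables) :
    (∃ hA : x ∈ S.clusterAlgebra K,
      ClusterAlg.IsStrongAtom (⟨x, hA⟩ : S.clusterAlgebra K)) ∧
    (∃ hU : x ∈ S.upperClusterAlgebra K,
      ClusterAlg.IsStrongAtom (⟨x, hU⟩ : S.upperClusterAlgebra K)) := by
  have : IsDomain K := hS.algebraicIndependent.algebraMap_injective.isDomain _
  have hI : S.IsIndepSeed K := ⟨hS.algebraicIndependent, hS.isExchangeMatrix⟩
  obtain ⟨T, hT, i, rfl⟩ := hx
  have hcol : ∀ j, (∀ l, T.B l j = 0) → ¬ IsUnit (2 : K) := by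
    -- Over a field there are no zero columns; over `ℤ` they are harmless because `2` is not a unit.
    rcases hK with hK | ⟨⟨f⟩⟩
    · intro j hj
      obtain ⟨l, hl⟩ := hT.exists_ne_zero
        (fun i => hS.isExchangeMatrix.exists_ne_zero_of_not_isIsolated (hiso hK i)) j
      exact absurd (hj l) hl
    · intro j _ h2
      have := h2.map f
      rw [map_ofNat] at this
      exact absurd this (by decide)
  have hle := hI.clusterAlgebra_le_upperClusterAlgebra
  exact ⟨hI.isStrongAtom_of_le hT hcol le_rfl hle i, hI.isStrongAtom_of_le hT hcol hle le_rfl i⟩
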